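/- Let $n\in\mathbb N$, $n\ge 1$, let $E_0<E_1<\dots<E_{2n}$ be real numbers, and put $$\Sigma_n=\bigcup_{j=0}^{n-1}[E_{2j},E_{2j+1}]\cup[E_{2n},\infty),\qquad R_{2n+1}(z)=\prod_{\ell=0}^{2n}(z-E_\ell).$$ Let $R_{2n+1}^{1/2}$ be the square root of $R_{2n+1}$ that is analytic on $\mathbb C\setminus\Sigma_n$ and whose values on $\mathbb R$, obtained as limits from the upper half-plane, $R_{2n+1}(\lambda)^{1/2}=\lim_{\varepsilon\downarrow0}R_{2n+1}(\lambda+i\varepsilon)^{1/2}$, are positive on $(E_{2n},\infty)$. A (scalar) Herglotz function is a function $M$ that is analytic on $\mathbb C_+=\{z:\operatorname{Im}z>0\}$ with $\operatorname{Im}M\ge0$ there, extended to the lower half-plane by $M(\overline z)=\overline{M(z)}$; at points $\lambda\in\mathbb R\setminus\Sigma_n$ it is given by $M(\lambda)=\lim_{\varepsilon\downarrow0}M(\lambda+i\varepsilon)$, if this limit exists. Let $M$ be a Herglotz function, not identically zero, such that $\lim_{\varepsilon\downarrow0}M(\lambda+i\varepsilon)$ exists and lies in $i\mathbb R$ for a.e.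 $\lambda\in\Sigma_n$, and such that for every $\lambda\in\mathbb R\setminus\Sigma_n$ the limit $M(\lambda)=\lim_{\varepsilon\downarrow0}M(\lambda+i\varepsilon)$ exists (in $\mathbb C$) and is real. Then exactly one of the following two alternatives holds: (a) $$M(z)=\frac{i\widehat F_n(z)}{R_{2n+1}(z)^{1/2}},\qquad z\in\mathbb C\setminus\Sigma_n,$$ where $\widehat F_n$ is a real polynomial of degree $n$ (not necessarily monic), positive on $(E_{2n},\infty)$, with precisely one zero in each of the intervals $[E_{2j-1},E_{2j}]$, $1\le j\le n$; (b) $$M(z)=\frac{i\widehat H_{n+1}(z)}{R_{2n+1}(z)^{1/2}},\qquad z\in\mathbb C\setminus\Sigma_n,$$ where $\widehat H_{n+1}$ is a real polynomial of degree $n+1$ (not necessarily monic), positive on $(E_{2n},\infty)$, with precisely one zero in each of the intervals $(-\infty,E_0]$ and $[E_{2j-1},E_{2j}]$, $1\le j\le n$. Moreover, if $\widehat F_n$ is a polynomial of degree $n$ such that $i\widehat F_n/R_{2n+1}^{1/2}$ is a Herglotz function, then for all $z\in\mathbb C\setminus\Sigma_n$ $$\frac{i\widehat F_n(z)}{R_{2n+1}(z)^{1/2}}=\frac1\pi\int_{\Sigma_n}\frac{\widehat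 F_n(\lambda)\,d\lambda}{R_{2n+1}(\lambda)^{1/2}}\,\frac1{\lambda-z},$$ and if $\widehat H_{n+1}$ is a polynomial of degree $n+1$ such that $i\widehat H_{n+1}/R_{2n+1}^{1/2}$ is a Herglotz function, then for all $z\in\mathbb C\setminus\Sigma_n$ $$\frac{i\widehat H_{n+1}(z)}{R_{2n+1}(z)^{1/2}}=\operatorname{Re}\left(\frac{i\widehat H_{n+1}(i)}{R_{2n+1}(i)^{1/2}}\right)+\frac1\pi\int_{\Sigma_n}\frac{\widehat H_{n+1}(\lambda)\,d\lambda}{R_{2n+1}(\lambda)^{1/2}}\left(\frac1{\lambda-z}-\frac{\lambda}{1+\lambda^2}\right),$$ both integrals being absolutely convergent. -/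

import Mathlib

open Set Filter Topology MeasureTheory
open scoped ComplexConjugate

noncomputable section

namespace FiniteBand

/-- The finite-band set `Σ_n = ⋃_{j=0}^{n-1} [E_{2j}, E_{2j+1}] ∪ [E_{2n}, ∞)`.
Only the numbers `E 0, …, E (2 * n)` matter. -/
def bandSet (n : ℕ) (E : ℕ → ℝ) : Set ℝ :=
  (⋃ j ∈ Set.Iio n, Set.Icc (E (2 * j)) (E (2 * j + 1))) ∪ Set.Ici (E (2 * n))

/-- The complement `ℂ \ Σ_n`, where `Σ_n ⊆ ℝ ⊆ ℂ`. -/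
def offBands (n : ℕ) (E : ℕ → ℝ) : Set ℂ :=
  (Complex.ofReal '' bandSet n E)ᶜ

/-- `∏_{ℓ=0}^{2n} (z - E_ℓ)^{1/2}` with principal square roots. -/
def sqrtProd (n : ℕ) (E : ℕ → ℝ) (z : ℂ) : ℂ :=
  ∏ l ∈ Finset.range (2 * n + 1), (z - (E l : ℂ)) ^ (1 / 2 : ℂ)

/-- The square root `R_{2n+1}(z)^{1/2}` of `R_{2n+1}(z) = ∏_{ℓ=0}^{2n} (z - E_ℓ)`.
On the closed upper half-plane the principal square root is continuous, so there the function is the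
product of the principal roots of the factors: it is analytic on `ℂ₊`, its values on `ℝ` are the
limits from `ℂ₊`, it is positive on `(E_{2n}, ∞)`, and it picks up a factor `i` each time
some `E_ℓ` is passed from right to left. In the lower half-plane it is given by the reflection
`R(z)^{1/2} = - conj (R(conj z)^{1/2})`, which agrees with the values on `ℝ \ Σ_n` (these are
purely imaginary); hence it is the analytic continuation to `ℂ \ Σ_n`. -/
def sqrtR (n : ℕ) (E : ℕ → ℝ) (z : ℂ) : ℂ :=
  if 0 ≤ z.im then sqrtProd n E z else -conj (sqrtProd n E (conj z))

/-- A scalar Herglotz function: analytic on `ℂ₊`, with nonnegative imaginary part there, and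
extended to `ℂ₋` by `M (conj z) = conj (M z)`. -/
structure IsHerglotz (M : ℂ → ℂ) : Prop where
  analytic : DifferentiableOn ℂ M {z : ℂ | 0 < z.im}
  im_nonneg : ∀ z : ℂ, 0 < z.im → 0 ≤ (M z).im
  symm : ∀ z : ℂ, 0 < z.im → M (conj z) = conj (M z)

/-- The boundary value `lim_{ε ↓ 0} M (x + i ε)` exists and equals `w`. -/
def HasBoundaryValue (M : ℂ → ℂ) (x : ℝ) (w : ℂ) : Prop :=
  Tendsto (fun ε : ℝ => M ((x : ℂ) + (ε : ℂ) * Complex.I)) (𝓝[>] (0 : ℝ)) (𝓝 w)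

/-- The polynomial `F` has precisely one zero in the set `s`. -/
def OneZeroIn (F : Polynomial ℝ) (s : Set ℝ) : Prop :=
  ∃! x : ℝ, x ∈ s ∧ F.IsRoot x

end FiniteBand

end

noncomputable section

namespace FiniteBand

/-! Form of `M`. A real constant with imaginary boundary values on a band is zero, so `Im M > 0` and
`log M` is holomorphic in the upper half-plane with bounded imaginary part. Such a function is
determined, up to a real additive constant, by the boundary values of its imaginary part a.e. on the
line: if `h` has bounded imaginary part with boundary values `0` a.e., then `exp (± i h)` is bounded
with boundary modulus `1`, and the Poisson formula makes `Im h` vanish (`im_eq_zero_of_ae_tendsto`).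
It remains to find `arg M` a.e. Boundary values vanish only on a null set
(`ae_not_hasBoundaryValue_zero`), so the argument is `π / 2` a.e. on the bands.

Off the bands `M` is real, and the boundary measure of `Im M` has no mass there, so `M` is
nondecreasing on each gap (`monotoneOn_boundaryValue`). Hence it changes sign at most once, from
negative to positive, at some `μ_j`, and its argument jumps from `π` to `0` there. This is also the
argument of `i ∏ (z - μ_j) / R^{1/2}`, so the two functions differ by a positive factor
(`exists_eq_mul_of_arg_eq`). On `(-∞, E_0)` either `M ≥ 0` throughout, giving degree `n`, or `M` is
negative somewhere, giving one more zero and degree `n + 1`. The quotient determines its polynomial,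
so the alternatives exclude each other.

Integral representations. Put `q = i F / R^{1/2}`. Shifted upwards, `q` is holomorphic across the
real line and grows at most like `|w|^{1/2}`, so Cauchy's theorem evaluates its integrals against
differences of Cauchy kernels. The shift is removed by dominated convergence, since the edges carry
only inverse square root singularities. On the line `q` is imaginary on the bands and real off them,
so subtracting a conjugate integral leaves an integral over the bands alone
(`setIntegral_bandSet_eq`). `representation_offBands` passes from the upper half-plane to the gaps
by a limit and to the lower half-plane by reflection. -/

/-- Neighbourhoods of infinity within the closed upper half-plane. -/
abbrev upperInfty : Filter ℂ := Bornology.cobounded ℂ ⊓ 𝓟 {w : ℂ | 0 ≤ w.im}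

/-! ### Growth at infinity and contour integration in the upper half-plane -/

lemma isBigO_one_add_norm_rpow_mono {E : Type*} [NormedAddCommGroup E] {a b : ℝ} (hab : a ≤ b)
    (l : Filter E) :
    (fun w : E => (1 + ‖w‖) ^ a) =O[l] fun w : E => (1 + ‖w‖) ^ b := by
  refine Asymptotics.IsBigO.of_norm_le fun w => ?_
  have h1 : (1 : ℝ) ≤ 1 + ‖w‖ := by linarith [norm_nonneg w]
  rw [Real.norm_of_nonneg (by positivity)]
  exact Real.rpow_le_rpow_of_exponent_le h1 hab

lemma one_add_norm_rpow_mul {E : Type*} [NormedAddCommGroup E] (a b : ℝ) (w : E) :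
    (1 + ‖w‖) ^ a * (1 + ‖w‖) ^ b = (1 + ‖w‖) ^ (a + b) :=
  (Real.rpow_add (by positivity) a b).symm

lemma isBigO_inv_sub (p : ℂ) :
    (fun w : ℂ => (w - p)⁻¹) =O[Bornology.cobounded ℂ] fun w : ℂ => (1 + ‖w‖) ^ (-1 : ℝ) := by
  refine Asymptotics.IsBigO.of_bound 2 ?_
  have : ∀ᶠ w : ℂ in Bornology.cobounded ℂ, 2 * ‖p‖ + 1 ≤ ‖w‖ :=
    tendsto_norm_cobounded_atTop.eventually_ge_atTop _
  filter_upwards [this] with w hw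
  rw [Real.rpow_neg_one, norm_inv, Real.norm_of_nonneg (by positivity)]
  have h1 : ‖w‖ - ‖p‖ ≤ ‖w - p‖ := norm_sub_norm_le w p
  have h2 : 0 < ‖w - p‖ := by linarith [norm_nonneg p]
  rw [← div_eq_mul_inv, inv_eq_one_div, div_le_div_iff₀ h2 (by positivity)]
  linarith

lemma tendsto_ofReal_upperInfty : Tendsto (fun t : ℝ => (t : ℂ)) (cocompact ℝ) upperInfty := by
  refine tendsto_inf.2 ⟨?_, tendsto_principal.2 (Eventually.of_forall fun t => by simp)⟩
  rw [← tendsto_norm_atTop_iff_cobounded]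
  simpa only [Complex.norm_real] using tendsto_norm_cocompact_atTop (E := ℝ)

lemma integrable_of_isBigO {k : ℝ → ℂ} (hk : LocallyIntegrable k)
    (hO : k =O[cocompact ℝ] fun t : ℝ => (1 + ‖t‖) ^ (-(3 / 2) : ℝ)) : Integrable k :=
  hk.integrable_of_isBigO_cocompact hO
    ((integrable_one_add_norm (by norm_num)).integrableAtFilter _)

theorem integrable_ofReal_of_isBigO {k : ℂ → ℂ} {δ : ℝ} (hδ : 0 < δ)
    (hk : DifferentiableOn ℂ k {w : ℂ | -δ < w.im})
    (hO : k =O[upperInfty] fun w : ℂ => (1 + ‖w‖) ^ (-(3 / 2) : ℝ)) :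
    Integrable fun t : ℝ => k t := by
  refine integrable_of_isBigO (Continuous.locallyIntegrable ?_) ?_
  · exact hk.continuousOn.comp_continuous Complex.continuous_ofReal fun t => by simpa using hδ
  · simpa [Function.comp_def] using hO.comp_tendsto tendsto_ofReal_upperInfty

/-- A function holomorphic near the closed upper half-plane and decaying faster than `1 / |w|` has
vanishing integral over the real line. -/
theorem integral_ofReal_eq_zero {k : ℂ → ℂ} {δ : ℝ} (hδ : 0 < δ)
    (hk : DifferentiableOn ℂ k {w : ℂ | -δ < w.im})
    (hO : k =O[upperInfty] fun w : ℂ => (1 + ‖w‖) ^ (-(3 / 2) : ℝ)) :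
    ∫ t : ℝ, k t = 0 := by
  have hint := integrable_ofReal_of_isBigO hδ hk hO
  obtain ⟨C, hC0, hC⟩ := hO.exists_pos
  rw [Asymptotics.IsBigOWith_def, eventually_inf_principal,
    (hasBasis_cobounded_norm (E := ℂ)).eventually_iff] at hC
  obtain ⟨R₀, -, hR₀⟩ := hC
  have hbound : ∀ R : ℝ, max R₀ 1 ≤ R → ∀ w : ℂ, 0 ≤ w.im → R ≤ ‖w‖ →
      ‖k w‖ ≤ C * R ^ (-(3 / 2) : ℝ) := by
    intro R hR w hw hRw
    have h1 : 0 < R := lt_of_lt_of_le one_pos (le_trans (le_max_right _ _) hR)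
    refine (hR₀ (le_trans (le_trans (le_max_left _ _) hR) hRw) hw).trans ?_
    rw [Real.norm_of_nonneg (by positivity)]
    gcongr ?_ * ?_
    exact Real.rpow_le_rpow_of_nonpos h1 (by linarith) (by norm_num)
  have hlim : Tendsto (fun R : ℝ => ∫ t in (-R)..R, k t) atTop (𝓝 (∫ t : ℝ, k t)) :=
    intervalIntegral_tendsto_integral hint tendsto_neg_atTop_atBot tendsto_id
  -- The other three sides of the rectangle with base `[-R, R]` and height `R` have total length `4
  -- R`, and there `‖k‖ ≤ C R^(-3/2)`.
  refine tendsto_nhds_unique hlim (squeeze_zero_norm' (a := fun R => 4 * C * R ^ (-(1 / 2) : ℝ)) ?_ ?_)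
  · filter_upwards [eventually_ge_atTop (max R₀ 1)] with R hR
    have h1 : 0 < R := lt_of_lt_of_le one_pos (le_trans (le_max_right _ _) hR)
    have key := Complex.integral_boundary_rect_eq_zero_of_differentiableOn k (-R : ℝ) ⟨R, R⟩
      (hk.mono fun w hw => by
        have := hw.2
        simp [uIcc_of_le h1.le] at this
        simp only [mem_ofPred_eq]
        linarith [this.1])
    simp only [Complex.ofReal_re, Complex.ofReal_im, Complex.ofReal_zero, zero_mul, add_zero] at key
    have e1 : ‖∫ x in (-R)..R, k (x + R * Complex.I)‖ ≤ C * R ^ (-(3 / 2) : ℝ) * |R - -R| := by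
      refine intervalIntegral.norm_integral_le_of_norm_le_const fun x _ => ?_
      refine hbound R hR _ (by simp [h1.le]) ?_
      simpa [abs_of_pos h1] using Complex.abs_im_le_norm ((x : ℂ) + R * Complex.I)
    have e2 : ‖∫ y in (0 : ℝ)..R, k (R + y * Complex.I)‖ ≤ C * R ^ (-(3 / 2) : ℝ) * |R - 0| := by
      refine intervalIntegral.norm_integral_le_of_norm_le_const fun y hy => ?_
      rw [uIoc_of_le h1.le] at hy
      refine hbound R hR _ (by simp [hy.1.le]) ?_
      simpa [abs_of_pos h1] using Complex.abs_re_le_norm ((R : ℂ) + y * Complex.I)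
    have e3 : ‖∫ y in (0 : ℝ)..R, k ((-R : ℝ) + y * Complex.I)‖
        ≤ C * R ^ (-(3 / 2) : ℝ) * |R - 0| := by
      refine intervalIntegral.norm_integral_le_of_norm_le_const fun y hy => ?_
      rw [uIoc_of_le h1.le] at hy
      refine hbound R hR _ (by simp [hy.1.le]) ?_
      simpa [abs_of_pos h1] using Complex.abs_re_le_norm (((-R : ℝ) : ℂ) + y * Complex.I)
    have e4 : (∫ x in (-R)..R, k x) = (∫ x in (-R)..R, k (x + R * Complex.I))
        - Complex.I • (∫ y in (0 : ℝ)..R, k (R + y * Complex.I))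
        + Complex.I • (∫ y in (0 : ℝ)..R, k ((-R : ℝ) + y * Complex.I)) := by
      linear_combination (exp := 1) key
    rw [e4]
    refine (norm_add_le _ _).trans ((add_le_add (norm_sub_le _ _) le_rfl).trans ?_)
    rw [norm_smul, norm_smul, Complex.norm_I, one_mul, one_mul]
    have e5 : R ^ (-(1 / 2) : ℝ) = R ^ (-(3 / 2) : ℝ) * R := by
      rw [← Real.rpow_add_one h1.ne']; norm_num
    rw [e5]
    rw [abs_of_pos (by linarith)] at e1 e2 e3
    nlinarith [e1, e2, e3]
  · simpa using (tendsto_rpow_neg_atTop (show (0 : ℝ) < 1 / 2 by norm_num)).const_mul (4 * C)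

lemma isBigO_inv_sub_mul_inv_sub (p q : ℂ) :
    (fun w : ℂ => (w - p)⁻¹ * (w - q)⁻¹) =O[upperInfty] fun w : ℂ => (1 + ‖w‖) ^ (-2 : ℝ) := by
  have := ((isBigO_inv_sub p).mul (isBigO_inv_sub q)).mono
    (inf_le_left (b := 𝓟 {w : ℂ | 0 ≤ w.im}))
  simp only [one_add_norm_rpow_mul] at this
  norm_num at this ⊢
  exact this

lemma isBigO_mul_inv_sub_mul_inv_sub {g : ℂ → ℂ} (p q : ℂ)
    (hO : g =O[upperInfty] fun w : ℂ => (1 + ‖w‖) ^ (1 / 2 : ℝ)) :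
    (fun w : ℂ => g w * ((w - p)⁻¹ * (w - q)⁻¹)) =O[upperInfty]
      fun w : ℂ => (1 + ‖w‖) ^ (-(3 / 2) : ℝ) := by
  have := hO.mul (isBigO_inv_sub_mul_inv_sub p q)
  simp only [one_add_norm_rpow_mul] at this
  norm_num at this ⊢
  exact this

lemma inv_sub_inv_eq_mul {t p q : ℂ} (hp : t ≠ p) (hq : t ≠ q) :
    (t - p)⁻¹ - (t - q)⁻¹ = (p - q) * ((t - p)⁻¹ * (t - q)⁻¹) := by
  have h1 := sub_ne_zero.2 hp
  have h2 := sub_ne_zero.2 hq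
  field_simp
  ring

lemma ofReal_ne_of_im_ne_zero {p : ℂ} (hp : p.im ≠ 0) (t : ℝ) : (t : ℂ) ≠ p := by
  rintro rfl
  simp at hp

lemma differentiableOn_inv_sub {p : ℂ} {s : Set ℂ} (hp : p ∉ s) :
    DifferentiableOn ℂ (fun w : ℂ => (w - p)⁻¹) s :=
  (differentiableOn_id.sub_const p).inv fun _ hw => sub_ne_zero.2 fun h => hp (h ▸ hw)

lemma halfPlane_mono {η δ : ℝ} (h : η ≤ δ) : {w : ℂ | -η < w.im} ⊆ {w : ℂ | -δ < w.im} := by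
  intro w hw
  rw [mem_ofPred_eq] at hw ⊢
  linarith

/-- Cauchy's theorem in the upper half-plane for two poles in the lower half-plane. -/
theorem integral_mul_inv_sub_sub_inv_sub_eq_zero {g : ℂ → ℂ} {δ : ℝ} (hδ : 0 < δ)
    (hg : DifferentiableOn ℂ g {w : ℂ | -δ < w.im})
    (hO : g =O[upperInfty] fun w : ℂ => (1 + ‖w‖) ^ (1 / 2 : ℝ)) {p q : ℂ}
    (hp : p.im < 0) (hq : q.im < 0) :
    ∫ t : ℝ, g t * (((t : ℂ) - p)⁻¹ - ((t : ℂ) - q)⁻¹) = 0 := by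
  -- The half-plane `Im w > -η` avoids both poles and stays in the domain of `g`.
  obtain ⟨η, hη0, hη⟩ : ∃ η : ℝ, 0 < η ∧ η ≤ δ ∧ p.im ≤ -η ∧ q.im ≤ -η :=
    ⟨min δ (min (-p.im) (-q.im)), by simp [hδ, hp, hq], by simp, by
      linarith [(min_le_right δ (min (-p.im) (-q.im))).trans (min_le_left _ _)], by
      linarith [(min_le_right δ (min (-p.im) (-q.im))).trans (min_le_right _ _)]⟩
  have key := integral_ofReal_eq_zero (k := fun w => g w * ((w - p)⁻¹ * (w - q)⁻¹)) hη0
    ((hg.mono (halfPlane_mono hη.1)).mul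
      ((differentiableOn_inv_sub (by simp; exact hη.2.1)).mul
        (differentiableOn_inv_sub (by simp; exact hη.2.2))))
    (isBigO_mul_inv_sub_mul_inv_sub p q hO)
  have e : ∀ t : ℝ, g t * (((t : ℂ) - p)⁻¹ - ((t : ℂ) - q)⁻¹)
      = (p - q) * (g t * (((t : ℂ) - p)⁻¹ * ((t : ℂ) - q)⁻¹)) := fun t => by
    rw [inv_sub_inv_eq_mul (ofReal_ne_of_im_ne_zero hp.ne t) (ofReal_ne_of_im_ne_zero hq.ne t)]
    ring
  simp_rw [e]
  rw [integral_const_mul, key, mul_zero]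

/-- The Cauchy kernel minus its reflection is a multiple of the Poisson kernel, which is the density
of a Cauchy distribution. Positivity and total mass one come from there. -/
lemma inv_sub_sub_inv_sub_conj (p : ℂ) (hp : 0 < p.im) (t : ℝ) :
    ((t : ℂ) - p)⁻¹ - ((t : ℂ) - conj p)⁻¹
      = 2 * Real.pi * Complex.I *
        (ProbabilityTheory.cauchyPDFReal p.re p.im.toNNReal t : ℂ) := by
  rw [inv_sub_inv_eq_mul (ofReal_ne_of_im_ne_zero hp.ne' t)
    (ofReal_ne_of_im_ne_zero (by simpa using hp.ne') t), ← mul_inv]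
  have h2 : ((t : ℂ) - p) * ((t : ℂ) - conj p) = (((t - p.re) ^ 2 + p.im ^ 2 : ℝ) : ℂ) := by
    apply Complex.ext <;> simp [pow_two] <;> ring
  have h3 : p - conj p = 2 * p.im * Complex.I := by
    apply Complex.ext <;> simp <;> ring
  have hpi : (Real.pi : ℂ) ≠ 0 := by exact_mod_cast Real.pi_ne_zero
  rw [h2, h3, ProbabilityTheory.cauchyPDFReal_def]
  push_cast
  rw [Real.coe_toNNReal _ hp.le]
  field_simp

/-- The Poisson formula for a holomorphic function of moderate growth. -/
theorem integral_mul_inv_sub_sub_inv_sub_conj {g : ℂ → ℂ} {δ : ℝ} (hδ : 0 < δ)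
    (hg : DifferentiableOn ℂ g {w : ℂ | -δ < w.im})
    (hO : g =O[upperInfty] fun w : ℂ => (1 + ‖w‖) ^ (1 / 2 : ℝ)) {p : ℂ} (hp : 0 < p.im) :
    Integrable (fun t : ℝ => g t * (((t : ℂ) - p)⁻¹ - ((t : ℂ) - conj p)⁻¹)) ∧
    ∫ t : ℝ, g t * (((t : ℂ) - p)⁻¹ - ((t : ℂ) - conj p)⁻¹) = 2 * Real.pi * Complex.I * g p := by
  set η := min δ p.im with hη
  have hη0 : 0 < η := by simp [hη, hδ, hp]
  have hηδ : η ≤ δ := min_le_left _ _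
  have hηp : η ≤ p.im := min_le_right _ _
  have hopen : IsOpen {w : ℂ | -η < w.im} := isOpen_lt continuous_const Complex.continuous_im
  have hnhds : {w : ℂ | -η < w.im} ∈ 𝓝 p := hopen.mem_nhds (by simp; linarith)
  have hg' : DifferentiableOn ℂ g {w : ℂ | -η < w.im} :=
    hg.mono (halfPlane_mono hηδ)
  -- Subtracting `g p` removes the pole at `p`: the difference quotient contributes an integral
  -- equal to zero, and what remains is `g p` times the total mass of the Poisson kernel.
  have hd : DifferentiableOn ℂ (dslope g p) {w : ℂ | -η < w.im} :=
    (Complex.differentiableOn_dslope hnhds).2 hg'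
  have hc : (fun _ : ℂ => g p) =O[upperInfty] fun w : ℂ => (1 + ‖w‖) ^ (1 / 2 : ℝ) := by
    refine Asymptotics.IsBigO.trans ?_
      (isBigO_one_add_norm_rpow_mono (a := 0) (by norm_num) upperInfty)
    simpa using Asymptotics.isBigO_const_const (g p) (one_ne_zero (α := ℝ)) upperInfty
  have hO' := isBigO_mul_inv_sub_mul_inv_sub p (conj p) (hO.sub hc)
  have hev : (fun w : ℂ => dslope g p w * (w - conj p)⁻¹) =ᶠ[upperInfty]
      fun w => (g w - g p) * ((w - p)⁻¹ * (w - conj p)⁻¹) := by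
    have : ∀ᶠ w : ℂ in upperInfty, w ≠ p := by
      refine Filter.Eventually.filter_mono inf_le_left ?_
      filter_upwards [tendsto_norm_cobounded_atTop.eventually_gt_atTop ‖p‖] with w hw h
      simp [h] at hw
    filter_upwards [this] with w hw
    rw [dslope_of_ne g hw, slope_def_field]
    ring
  have hk := hd.mul (differentiableOn_inv_sub (p := conj p) (s := {w : ℂ | -η < w.im})
    (by simp; exact hηp))
  have hO2 := hev.trans_isBigO hO'
  have key : ∫ t : ℝ, dslope g p t * ((t : ℂ) - conj p)⁻¹ = 0 :=
    integral_ofReal_eq_zero hη0 hk hO2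
  have hi : Integrable fun t : ℝ => dslope g p t * ((t : ℂ) - conj p)⁻¹ :=
    integrable_ofReal_of_isBigO hη0 hk hO2
  have e : ∀ t : ℝ, g t * (((t : ℂ) - p)⁻¹ - ((t : ℂ) - conj p)⁻¹)
      = (p - conj p) * (dslope g p t * ((t : ℂ) - conj p)⁻¹)
        + 2 * Real.pi * Complex.I * g p *
          (ProbabilityTheory.cauchyPDFReal p.re p.im.toNNReal t : ℂ) := fun t => by
    have hne := ofReal_ne_of_im_ne_zero hp.ne' t
    rw [mul_right_comm _ (g p), ← inv_sub_sub_inv_sub_conj p hp,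
      inv_sub_inv_eq_mul hne
      (ofReal_ne_of_im_ne_zero (by simpa using hp.ne') t), dslope_of_ne g hne, slope_def_field]
    ring
  have hcI : Integrable fun t : ℝ =>
      (ProbabilityTheory.cauchyPDFReal p.re p.im.toNNReal t : ℂ) :=
    (ProbabilityTheory.integrable_cauchyPDFReal _).ofReal
  simp_rw [e]
  refine ⟨(hi.const_mul _).add (hcI.const_mul _), ?_⟩
  rw [integral_add (hi.const_mul _) (hcI.const_mul _), integral_const_mul, integral_const_mul]
  have : ∫ t : ℝ, (ProbabilityTheory.cauchyPDFReal p.re p.im.toNNReal t : ℂ) = 1 := by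
    rw [integral_complex_ofReal, ProbabilityTheory.integral_cauchyPDFReal_eq_one]
    · simp
    · exact (Real.toNNReal_pos.2 hp).ne'
  rw [this, key]
  ring

/-! ### Poisson measures and bounded holomorphic functions -/

/-- The Poisson kernel of the upper half-plane at `z`, as a probability measure on `ℝ`. -/
def poissonMeasure (z : ℂ) : Measure ℝ := ProbabilityTheory.cauchyMeasure z.re z.im.toNNReal

instance (z : ℂ) : IsProbabilityMeasure (poissonMeasure z) := by
  unfold poissonMeasure; infer_instance

lemma poissonMeasure_eq {z : ℂ} (hz : 0 < z.im) : poissonMeasure z =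
    volume.withDensity (ProbabilityTheory.cauchyPDF z.re z.im.toNNReal) :=
  ProbabilityTheory.cauchyMeasure_of_scale_ne_zero _ (Real.toNNReal_pos.2 hz).ne'

lemma poissonMeasure_absolutelyContinuous {z : ℂ} (hz : 0 < z.im) :
    poissonMeasure z ≪ volume := by
  rw [poissonMeasure_eq hz]
  exact withDensity_absolutelyContinuous _ _

lemma absolutelyContinuous_poissonMeasure {z : ℂ} (hz : 0 < z.im) :
    volume ≪ poissonMeasure z := by
  rw [poissonMeasure_eq hz]
  refine withDensity_absolutelyContinuous' (by fun_prop) (Eventually.of_forall fun t => ?_)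
  rw [ProbabilityTheory.cauchyPDF_def]
  simpa using ProbabilityTheory.cauchyPDF_pos z.re (Real.toNNReal_pos.2 hz).ne' t

lemma toReal_cauchyPDF {z : ℂ} (hz : 0 < z.im) (t : ℝ) :
    (ProbabilityTheory.cauchyPDF z.re z.im.toNNReal t).toReal =
      ProbabilityTheory.cauchyPDFReal z.re z.im.toNNReal t := by
  rw [ProbabilityTheory.cauchyPDF_def, ENNReal.toReal_ofReal]
  exact (ProbabilityTheory.cauchyPDF_pos z.re (Real.toNNReal_pos.2 hz).ne' t).le

lemma integral_poissonMeasure {E : Type*} [NormedAddCommGroup E] [NormedSpace ℝ E] {z : ℂ}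
    (hz : 0 < z.im) (g : ℝ → E) : ∫ t, g t ∂poissonMeasure z =
      ∫ t, ProbabilityTheory.cauchyPDFReal z.re z.im.toNNReal t • g t := by
  rw [poissonMeasure_eq hz, integral_withDensity_eq_integral_toReal_smul (by fun_prop)
    (Eventually.of_forall fun t => by rw [ProbabilityTheory.cauchyPDF_def]; simp)]
  simp_rw [toReal_cauchyPDF hz]

lemma im_add_mul_I (z : ℂ) (ε : ℝ) : (z + ε * Complex.I).im = z.im + ε := by simp

/-- The Poisson formula for a bounded holomorphic function, on a shifted line. -/
theorem eq_integral_poissonMeasure {f : ℂ → ℂ} {C : ℝ}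
    (hf : DifferentiableOn ℂ f {w : ℂ | 0 < w.im}) (hC : ∀ w : ℂ, 0 < w.im → ‖f w‖ ≤ C)
    {z : ℂ} (hz : 0 < z.im) {ε : ℝ} (hε : 0 < ε) :
    f (z + ε * Complex.I) = ∫ t : ℝ, f (t + ε * Complex.I) ∂poissonMeasure z := by
  have hg : DifferentiableOn ℂ (fun w => f (w + ε * Complex.I)) {w : ℂ | -ε < w.im} := by
    refine hf.comp (by fun_prop) fun w hw => ?_
    rw [mem_ofPred_eq] at hw ⊢
    rw [im_add_mul_I]
    linarith
  have hO : (fun w => f (w + ε * Complex.I)) =O[upperInfty]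
      fun w : ℂ => (1 + ‖w‖) ^ (1 / 2 : ℝ) := by
    refine Asymptotics.IsBigO.trans ?_
      (isBigO_one_add_norm_rpow_mono (a := 0) (by norm_num) upperInfty)
    refine Asymptotics.IsBigO.of_bound C ?_
    filter_upwards [mem_inf_of_right (mem_principal_self _)] with w hw
    simpa using hC (w + ε * Complex.I) (by rw [im_add_mul_I]; linarith)
  have key := (integral_mul_inv_sub_sub_inv_sub_conj hε hg hO hz).2
  simp_rw [inv_sub_sub_inv_sub_conj z hz] at key
  rw [integral_poissonMeasure hz]
  have e : ∀ t : ℝ, f (t + ε * Complex.I) * (2 * Real.pi * Complex.I *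
      (ProbabilityTheory.cauchyPDFReal z.re z.im.toNNReal t : ℂ)) = (2 * Real.pi * Complex.I) *
      (ProbabilityTheory.cauchyPDFReal z.re z.im.toNNReal t • f (t + ε * Complex.I)) := fun t => by
    rw [Complex.real_smul]; ring
  simp_rw [e] at key
  rw [integral_const_mul] at key
  exact (mul_left_cancel₀ Complex.two_pi_I_ne_zero key).symm

lemma norm_le_integral_poissonMeasure {f : ℂ → ℂ} {C : ℝ}
    (hf : DifferentiableOn ℂ f {w : ℂ | 0 < w.im}) (hC : ∀ w : ℂ, 0 < w.im → ‖f w‖ ≤ C)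
    {z : ℂ} (hz : 0 < z.im) {ε : ℝ} (hε : 0 < ε) :
    ‖f (z + ε * Complex.I)‖ ≤ ∫ t : ℝ, ‖f (t + ε * Complex.I)‖ ∂poissonMeasure z := by
  rw [eq_integral_poissonMeasure hf hC hz hε]
  exact norm_integral_le_integral_norm _

lemma continuous_shift {f : ℂ → ℂ} (hf : DifferentiableOn ℂ f {w : ℂ | 0 < w.im}) {ε : ℝ}
    (hε : 0 < ε) : Continuous fun t : ℝ => f (t + ε * Complex.I) :=
  hf.continuousOn.comp_continuous (by fun_prop) fun t => by simpa using hε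

lemma continuousAt_of_im_pos {f : ℂ → ℂ} (hf : DifferentiableOn ℂ f {w : ℂ | 0 < w.im}) {z : ℂ}
    (hz : 0 < z.im) : ContinuousAt f z :=
  hf.continuousOn.continuousAt
    ((isOpen_lt continuous_const Complex.continuous_im).mem_nhds (by simpa using hz))

/-- A sequence of positive numbers tending to zero. -/
def heightSeq (k : ℕ) : ℝ := 1 / ((k : ℝ) + 1)

lemma heightSeq_pos (k : ℕ) : 0 < heightSeq k := by unfold heightSeq; positivity

lemma heightSeq_le_one (k : ℕ) : heightSeq k ≤ 1 := by
  unfold heightSeq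
  rw [div_le_one (by positivity)]
  linarith [(Nat.cast_nonneg k : (0 : ℝ) ≤ k)]

lemma tendsto_heightSeq : Tendsto heightSeq atTop (𝓝[>] 0) :=
  tendsto_nhdsWithin_iff.2 ⟨tendsto_one_div_add_atTop_nhds_zero_nat,
    Eventually.of_forall heightSeq_pos⟩

lemma tendsto_add_heightSeq {f : ℂ → ℂ} (hf : DifferentiableOn ℂ f {w : ℂ | 0 < w.im}) {z : ℂ}
    (hz : 0 < z.im) :
    Tendsto (fun k => f (z + heightSeq k * Complex.I)) atTop (𝓝 (f z)) := by
  have h : Tendsto (fun k => z + heightSeq k * Complex.I) atTop (𝓝 (z + (0 : ℝ) * Complex.I)) :=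
    tendsto_const_nhds.add (((Complex.continuous_ofReal.tendsto 0).comp
      (tendsto_heightSeq.mono_right nhdsWithin_le_nhds)).mul_const _)
  rw [Complex.ofReal_zero, zero_mul, add_zero] at h
  exact (continuousAt_of_im_pos hf hz).tendsto.comp h

/-! ### Uniqueness from boundary values -/

/-- Maximum principle: a bounded holomorphic function on the upper half-plane is bounded by any
number that bounds the limits of its modulus almost everywhere on the real line. -/
theorem norm_le_of_ae_tendsto {f : ℂ → ℂ} {C B : ℝ}
    (hf : DifferentiableOn ℂ f {w : ℂ | 0 < w.im}) (hC : ∀ w : ℂ, 0 < w.im → ‖f w‖ ≤ C)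
    (hlim : ∀ᵐ t : ℝ, Tendsto (fun ε : ℝ => ‖f (t + ε * Complex.I)‖) (𝓝[>] 0) (𝓝 B))
    {z : ℂ} (hz : 0 < z.im) : ‖f z‖ ≤ B := by
  have h1 : Tendsto (fun k => ∫ t : ℝ, ‖f (t + heightSeq k * Complex.I)‖ ∂poissonMeasure z) atTop
      (𝓝 (∫ _ : ℝ, B ∂poissonMeasure z)) := by
    refine tendsto_integral_of_dominated_convergence (fun _ => C)
      (fun k => (continuous_shift hf (heightSeq_pos k)).norm.aestronglyMeasurable)
      (integrable_const C) (fun k => Eventually.of_forall fun t => ?_) ?_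
    · rw [norm_norm]
      exact hC _ (by simpa using heightSeq_pos k)
    · filter_upwards [(poissonMeasure_absolutelyContinuous hz).ae_le hlim] with t ht
      exact ht.comp tendsto_heightSeq
  rw [integral_const, probReal_univ, one_smul] at h1
  exact le_of_tendsto_of_tendsto' (tendsto_add_heightSeq hf hz).norm h1
    fun k => norm_le_integral_poissonMeasure hf hC hz (heightSeq_pos k)

/-- A holomorphic function whose imaginary part is bounded and has zero boundary values almost
everywhere is real-valued. -/
theorem im_eq_zero_of_ae_tendsto {h : ℂ → ℂ} {C : ℝ}
    (hh : DifferentiableOn ℂ h {w : ℂ | 0 < w.im}) (hC : ∀ w : ℂ, 0 < w.im → |(h w).im| ≤ C)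
    (hlim : ∀ᵐ t : ℝ, Tendsto (fun ε : ℝ => (h (t + ε * Complex.I)).im) (𝓝[>] 0) (𝓝 0))
    {z : ℂ} (hz : 0 < z.im) : (h z).im = 0 := by
  -- The modulus of `exp (-i s h)` is `exp (s Im h)`, bounded with boundary values `1`. The signs `s
  -- = 1` and `s = -1` bound `Im h` from both sides.
  have key : ∀ s : ℝ, |s| = 1 → s * (h z).im ≤ 0 := by
    intro s hs
    have hn : ∀ w, ‖Complex.exp (-(s * Complex.I) * h w)‖ = Real.exp (s * (h w).im) := fun w => by
      rw [Complex.norm_exp]; simp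
    have := norm_le_of_ae_tendsto (f := fun w => Complex.exp (-(s * Complex.I) * h w))
      (C := Real.exp C) (B := Real.exp (s * 0)) (hh.const_mul _).cexp (fun w hw => ?_) ?_ hz
    · rw [hn, mul_zero, Real.exp_le_exp] at this
      exact this
    · rw [hn, Real.exp_le_exp]
      refine (le_abs_self _).trans ?_
      rw [abs_mul, hs, one_mul]
      exact hC w hw
    · filter_upwards [hlim] with t ht
      simp_rw [hn]
      exact (Real.continuous_exp.tendsto _).comp (ht.const_mul s)
  have h1 := key 1 (by simp)
  have h2 := key (-1) (by simp)
  linarith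

/-- A real-valued holomorphic function on the upper half-plane is constant. -/
theorem eq_const_of_im_eq_zero {h : ℂ → ℂ} (hh : DifferentiableOn ℂ h {w : ℂ | 0 < w.im})
    (him : ∀ w : ℂ, 0 < w.im → (h w).im = 0) : ∃ c : ℝ, ∀ w : ℂ, 0 < w.im → h w = c := by
  have hopen : IsOpen {w : ℂ | 0 < w.im} := isOpen_lt continuous_const Complex.continuous_im
  have hconv : Convex ℝ {w : ℂ | 0 < w.im} := convex_halfSpace_im_gt 0
  rcases (hh.analyticOnNhd hopen).is_constant_or_isOpen hconv.isPreconnected with ⟨c, hc⟩ | ho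
  · refine ⟨c.re, fun w hw => ?_⟩
    have h1 := hc w hw
    have h2 := him w hw
    rw [h1] at h2 ⊢
    exact Complex.ext (by simp) (by simp [h2])
  · exfalso
    have h1 := ho _ Subset.rfl hopen
    have hI : h Complex.I ∈ h '' {w : ℂ | 0 < w.im} := ⟨Complex.I, by simp, rfl⟩
    obtain ⟨r, hr, hball⟩ := Metric.isOpen_iff.1 h1 _ hI
    obtain ⟨w, hw, hw2⟩ := hball (show h Complex.I + (r / 2 : ℝ) * Complex.I ∈
        Metric.ball (h Complex.I) r by
      rw [Metric.mem_ball, dist_eq_norm, add_sub_cancel_left, norm_mul, Complex.norm_I,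
        Complex.norm_real, Real.norm_of_nonneg (by positivity)]
      linarith)
    have h3 := him w hw
    rw [hw2, im_add_mul_I, him _ (by simp)] at h3
    linarith

/-- Either the imaginary part of a Herglotz function is positive, or the function is a real
constant. -/
theorem im_pos_or_eq_const {M : ℂ → ℂ} (hM : DifferentiableOn ℂ M {w : ℂ | 0 < w.im})
    (h0 : ∀ w : ℂ, 0 < w.im → 0 ≤ (M w).im) :
    (∀ w : ℂ, 0 < w.im → 0 < (M w).im) ∨ ∃ c : ℝ, ∀ w : ℂ, 0 < w.im → M w = c := by
  by_cases hpos : ∀ w : ℂ, 0 < w.im → 0 < (M w).im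
  · exact Or.inl hpos
  right
  push Not at hpos
  obtain ⟨z, hz, hz0⟩ := hpos
  have hz1 : (M z).im = 0 := le_antisymm hz0 (h0 z hz)
  refine eq_const_of_im_eq_zero hM fun w hw => ?_
  have hopen : IsOpen {w : ℂ | 0 < w.im} := isOpen_lt continuous_const Complex.continuous_im
  have hconv : Convex ℝ {w : ℂ | 0 < w.im} := convex_halfSpace_im_gt 0
  have hn : ∀ w, ‖Complex.exp (Complex.I * M w)‖ = Real.exp (-(M w).im) := fun w => by
    rw [Complex.norm_exp]; simp
  -- At a zero of `Im M` the modulus of `exp (i M)` attains its maximum `1`, so it is constant.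
  have := Complex.norm_eqOn_of_isPreconnected_of_isMaxOn (f := fun w => Complex.exp (Complex.I * M w))
    hconv.isPreconnected hopen (hM.const_mul _).cexp (c := z) hz (fun w hw => by
      simp only [mem_ofPred_eq, Function.comp_apply, hn, hz1, Real.exp_le_exp]
      linarith [h0 w hw]) hw
  simpa [hn, hz1] using this

/-- The boundary values of a function with values in the upper half-plane vanish only on a null
set. -/
theorem ae_not_hasBoundaryValue_zero {M : ℂ → ℂ} (hM : DifferentiableOn ℂ M {w : ℂ | 0 < w.im})
    (h0 : ∀ w : ℂ, 0 < w.im → 0 < (M w).im) : ∀ᵐ t : ℝ, ¬ HasBoundaryValue M t 0 := by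
  -- Convergence along a sequence of heights, rather than along all `ε`, makes `A` measurable at
  -- once.
  set A : Set ℝ := {t | Tendsto (fun k => M (t + heightSeq k * Complex.I)) atTop (𝓝 0)} with hA
  have hAm : MeasurableSet A :=
    measurableSet_tendsto (𝓝 0) fun k => (continuous_shift hM (heightSeq_pos k)).measurable
  have hI : (0 : ℝ) < Complex.I.im := by simp
  have hMI : ∀ w : ℂ, 0 < w.im → 0 < ((M w + Complex.I)).im := fun w hw => by
    simpa using (h0 w hw).trans (lt_add_one _)
  have slit : ∀ w : ℂ, 0 < w.im → w ∈ Complex.slitPlane := fun w hw => Or.inr hw.ne'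
  have ne0 : ∀ w : ℂ, 0 < w.im → w ≠ 0 := fun w hw h => by simp [h] at hw
  set q : ℂ → ℝ := fun w => ‖M w‖ / ‖M w + Complex.I‖ with hq
  have hq0 : ∀ w : ℂ, 0 < w.im → 0 < q w := fun w hw =>
    div_pos (norm_pos_iff.2 (ne0 _ (h0 w hw))) (norm_pos_iff.2 (ne0 _ (hMI w hw)))
  have hq1 : ∀ w : ℂ, 0 < w.im → q w ≤ 1 := fun w hw => by
    refine (div_le_one (norm_pos_iff.2 (ne0 _ (hMI w hw)))).2 ?_
    rw [Complex.norm_def, Complex.norm_def]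
    refine Real.sqrt_le_sqrt ?_
    rw [Complex.normSq_apply, Complex.normSq_apply]
    simp only [Complex.add_re, Complex.I_re, Complex.add_im, Complex.I_im]
    nlinarith [h0 w hw]
  -- Both `M` and `M + i` lie in the upper half-plane, so `(M / (M + i))^s` has a holomorphic
  -- branch; its modulus is at most `1` and tends to `0` on `A`. Its modulus at `i` is therefore at
  -- most the Poisson mass of the complement of `A`, and `s → 0` forces that mass to be `1`.
  have bound : ∀ s : ℝ, 0 < s → q Complex.I ^ s ≤ (poissonMeasure Complex.I).real Aᶜ := by
    intro s hs
    set f : ℂ → ℂ := fun w =>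
      Complex.exp (s * (Complex.log (M w) - Complex.log (M w + Complex.I))) with hfd
    have hfn : ∀ w : ℂ, 0 < w.im → ‖f w‖ = q w ^ s := fun w hw => by
      rw [hfd, Complex.norm_exp, Complex.re_ofReal_mul, Complex.sub_re, Complex.log_re,
        Complex.log_re, ← Real.log_div (norm_pos_iff.2 (ne0 _ (h0 w hw))).ne'
          (norm_pos_iff.2 (ne0 _ (hMI w hw))).ne', Real.rpow_def_of_pos (hq0 w hw), mul_comm]
    have hf : DifferentiableOn ℂ f {w : ℂ | 0 < w.im} := by
      refine (((hM.clog fun w hw => slit _ (h0 w hw)).sub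
        ((hM.add_const _).clog fun w hw => slit _ (hMI w hw))).const_mul _).cexp
    have hf1 : ∀ w : ℂ, 0 < w.im → ‖f w‖ ≤ 1 := fun w hw => by
      rw [hfn w hw]
      exact Real.rpow_le_one (hq0 w hw).le (hq1 w hw) hs.le
    -- Off `A` no limit of `‖f‖` is known, so `‖f‖` is replaced there by its bound `1`.
    have hlim : Tendsto (fun k => ∫ t : ℝ, (Aᶜ.indicator 1 t
          + A.indicator (fun t => ‖f (t + heightSeq k * Complex.I)‖) t) ∂poissonMeasure Complex.I)
        atTop (𝓝 (∫ t : ℝ, Aᶜ.indicator 1 t ∂poissonMeasure Complex.I)) := by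
      refine tendsto_integral_of_dominated_convergence (fun _ => (2 : ℝ)) (fun k => ?_)
        (integrable_const _) (fun k => Eventually.of_forall fun t => ?_)
        (Eventually.of_forall fun t => ?_)
      · exact ((measurable_one.indicator hAm.compl).add
          ((continuous_shift hf (heightSeq_pos k)).norm.measurable.indicator
            hAm)).aestronglyMeasurable
      · have := hf1 (t + heightSeq k * Complex.I) (by simpa using heightSeq_pos k)
        by_cases ht : t ∈ A
        · simp [ht]; linarith
        · simp [ht]
      · by_cases ht : t ∈ A
        · simp only [ht, not_true_eq_false, not_false_eq_true, mem_compl_iff, indicator_of_mem,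
            indicator_of_notMem, zero_add]
          have h1 : Tendsto (fun k => q (t + heightSeq k * Complex.I) ^ s) atTop (𝓝 (0 ^ s)) := by
            refine Tendsto.rpow_const ?_ (Or.inr hs.le)
            have h2 : Tendsto (fun k => M (t + heightSeq k * Complex.I)) atTop (𝓝 0) := ht
            have h3 : Tendsto (fun k => q (t + heightSeq k * Complex.I)) atTop
                (𝓝 (‖(0 : ℂ)‖ / ‖0 + Complex.I‖)) :=
              h2.norm.div (h2.add_const Complex.I).norm (by simp)
            simpa using h3
          rw [Real.zero_rpow hs.ne'] at h1
          refine h1.congr fun k => ?_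
          rw [hfn _ (by simpa using heightSeq_pos k)]
        · simp [ht]
    rw [integral_indicator_one hAm.compl] at hlim
    rw [← hfn _ hI]
    refine le_of_tendsto_of_tendsto' (tendsto_add_heightSeq hf hI).norm hlim fun k => ?_
    refine (norm_le_integral_poissonMeasure hf hf1 hI (heightSeq_pos k)).trans ?_
    refine integral_mono_of_nonneg (Eventually.of_forall fun t => norm_nonneg _) ?_
      (Eventually.of_forall fun t => ?_)
    · refine Integrable.of_bound ((measurable_one.indicator hAm.compl).add
          ((continuous_shift hf (heightSeq_pos k)).norm.measurable.indicator
            hAm)).aestronglyMeasurable 2 (Eventually.of_forall fun t => ?_)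
      have := hf1 (t + heightSeq k * Complex.I) (by simpa using heightSeq_pos k)
      by_cases ht : t ∈ A
      · simp [ht]; linarith
      · simp [ht]
    · have := hf1 (t + heightSeq k * Complex.I) (by simpa using heightSeq_pos k)
      by_cases ht : t ∈ A
      · simp [ht]
      · simpa [ht] using this
  have h1 : (1 : ℝ) ≤ (poissonMeasure Complex.I).real Aᶜ := by
    have h2 : Tendsto (fun s : ℝ => q Complex.I ^ s) (𝓝[>] 0) (𝓝 (q Complex.I ^ (0 : ℝ))) :=
      ((Real.continuousAt_const_rpow (hq0 _ hI).ne').tendsto).mono_left nhdsWithin_le_nhds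
    rw [Real.rpow_zero] at h2
    exact le_of_tendsto h2 (eventually_mem_nhdsWithin.mono fun s hs => bound s hs)
  rw [probReal_compl_eq_one_sub hAm] at h1
  have h2 : (poissonMeasure Complex.I).real A = 0 :=
    le_antisymm (by linarith) measureReal_nonneg
  have h3 : volume A = 0 := absolutelyContinuous_poissonMeasure hI
    ((measureReal_eq_zero_iff).1 h2)
  have h4 : ∀ᵐ t : ℝ, t ∉ A := measure_eq_zero_iff_ae_notMem.1 h3
  filter_upwards [h4] with t ht hbv
  exact ht (hbv.comp tendsto_heightSeq)

/-! ### The boundary measure of `Im M` and monotonicity in the gaps -/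

/-- A local form of the Poisson inequality for positive harmonic functions. -/
theorem integral_im_le {M : ℂ → ℂ} (hM : DifferentiableOn ℂ M {w : ℂ | 0 < w.im})
    (h0 : ∀ w : ℂ, 0 < w.im → 0 ≤ (M w).im) (x : ℝ) {r δ : ℝ} (hr : 0 < r) (hδ : 0 < δ) :
    ∫ t in (x - r)..(x + r), (M (t + δ * Complex.I)).im
      ≤ 2 * Real.pi * r * (M (x + (r + δ : ℝ) * Complex.I)).im := by
  set z : ℂ := x + r * Complex.I with hzd
  have hzre : z.re = x := by simp [hzd]
  have hzim : z.im = r := by simp [hzd]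
  have hz : 0 < z.im := by rw [hzim]; exact hr
  set v : ℝ → ℝ := fun t => (M (t + δ * Complex.I)).im with hv
  have hvc : Continuous v := Complex.continuous_im.comp (continuous_shift hM hδ)
  have hv0 : ∀ t, 0 ≤ v t := fun t => h0 _ (by simpa using hδ)
  have hz' : (x : ℂ) + (r + δ : ℝ) * Complex.I = z + δ * Complex.I := by
    rw [hzd]; push_cast; ring
  rw [hz']
  set v0 := (M (z + δ * Complex.I)).im with hv0d
  have hv00 : 0 ≤ v0 := h0 _ (by rw [im_add_mul_I]; linarith)
  obtain ⟨V, hV⟩ := (isCompact_Icc (a := x - r) (b := x + r)).bddAbove_image hvc.continuousOn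
  have hV : ∀ t ∈ Icc (x - r) (x + r), v t ≤ V := fun t ht => hV (mem_image_of_mem _ ht)
  have hVx : 0 ≤ V := (hv0 x).trans (hV x ⟨by linarith, by linarith⟩)
  set S := Ioc (x - r) (x + r) with hS
  have hle : x - r ≤ x + r := by linarith
  -- The Poisson formula for bounded functions does not apply to `M` itself, but it applies to `exp
  -- (i s M)`. Since `1 - exp (-s v)` is `s v` to first order, dividing by `s` and letting `s → 0`
  -- gives the estimate for `v`; the factor `1 + s V` is the error of this linearization.
  have key : ∀ s : ℝ, 0 < s → ∫ t in S, v t ≤ 2 * Real.pi * r * ((1 + s * V) * v0) := by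
    intro s hs
    set f : ℂ → ℂ := fun w => Complex.exp (s * Complex.I * M w) with hfd
    have hn : ∀ w, ‖f w‖ = Real.exp (-(s * (M w).im)) := fun w => by
      rw [hfd, Complex.norm_exp]; simp
    have hf : DifferentiableOn ℂ f {w : ℂ | 0 < w.im} := (hM.const_mul _).cexp
    have hf1 : ∀ w : ℂ, 0 < w.im → ‖f w‖ ≤ 1 := fun w hw => by
      rw [hn, Real.exp_le_one_iff, neg_nonpos]
      exact mul_nonneg hs.le (h0 w hw)
    have h1 := norm_le_integral_poissonMeasure hf hf1 hz hδ
    have hi : Integrable (fun t : ℝ => ‖f (t + δ * Complex.I)‖) (poissonMeasure z) :=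
      Integrable.of_bound (continuous_shift hf hδ).norm.aestronglyMeasurable 1
        (Eventually.of_forall fun t => by
          rw [norm_norm]; exact hf1 _ (by simpa using hδ))
    have h2 : ∫ t : ℝ, (1 - ‖f (t + δ * Complex.I)‖) ∂poissonMeasure z ≤ s * v0 := by
      rw [integral_sub (integrable_const _) hi, integral_const, probReal_univ, one_smul]
      rw [hn] at h1
      have := Real.one_sub_le_exp_neg (s * v0)
      linarith
    rw [integral_poissonMeasure hz] at h2
    set K : ℝ → ℝ := fun t => ProbabilityTheory.cauchyPDFReal z.re z.im.toNNReal t with hK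
    have hK0 : ∀ t, 0 ≤ K t := fun t =>
      (ProbabilityTheory.cauchyPDF_pos z.re (Real.toNNReal_pos.2 hz).ne' t).le
    have hKi : Integrable fun t : ℝ => K t • (1 - ‖f (t + δ * Complex.I)‖) := by
      refine (ProbabilityTheory.integrable_cauchyPDFReal z.re).mul_bdd (c := 1)
        (by exact (continuous_const.sub
          (continuous_shift hf hδ).norm).aestronglyMeasurable) (Eventually.of_forall fun t => ?_)
      have := hf1 (t + δ * Complex.I) (by simpa using hδ)
      rw [Real.norm_of_nonneg (by linarith)]
      linarith [norm_nonneg (f (t + δ * Complex.I))]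
    have hnn : ∀ t : ℝ, 0 ≤ K t • (1 - ‖f (t + δ * Complex.I)‖) := fun t =>
      mul_nonneg (hK0 t) (by
        have := hf1 (t + δ * Complex.I) (by simpa using hδ)
        linarith)
    have h3 := (setIntegral_le_integral (s := S) hKi (Eventually.of_forall hnn)).trans h2
    have h4 : ∫ t in S, (s / (2 * Real.pi * r * (1 + s * V))) * v t
        ≤ ∫ t in S, K t • (1 - ‖f (t + δ * Complex.I)‖) := by
      refine setIntegral_mono_on ?_ hKi.integrableOn measurableSet_Ioc fun t ht => ?_
      · exact (((hvc.const_mul _).continuousOn).integrableOn_Icc).mono_set Ioc_subset_Icc_self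
      · have ht' : t ∈ Icc (x - r) (x + r) := Ioc_subset_Icc_self ht
        -- For `|t - x| ≤ r` the Poisson kernel at height `r` is at least `r / (π (r² + r²))`; this
        -- is the source of the constant `2 π r`.
        have e1 : 1 / (2 * Real.pi * r) ≤ K t := by
          simp only [hK]
          rw [ProbabilityTheory.cauchyPDFReal_def, hzre, hzim, Real.coe_toNNReal _ hr.le]
          have h5 : (t - x) ^ 2 ≤ r ^ 2 := sq_le_sq' (by linarith [ht'.1]) (by linarith [ht'.2])
          have : Real.pi⁻¹ * r * ((t - x) ^ 2 + r ^ 2)⁻¹ = r / (Real.pi * ((t - x) ^ 2 + r ^ 2)) := by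
            field_simp
          rw [this, div_le_div_iff₀ (by positivity) (by positivity)]
          nlinarith [Real.pi_pos]
        -- From `exp a ≥ 1 + a` one gets `1 - exp (-a) ≥ a / (1 + a)`, used with `a = s v ≤ s V`.
        have e2 : s * v t / (1 + s * V) ≤ 1 - ‖f (t + δ * Complex.I)‖ := by
          rw [hn]
          have h5 : 0 ≤ s * v t := mul_nonneg hs.le (hv0 t)
          have h6 : s * v t ≤ s * V := by gcongr; exact hV t ht'
          have h7 : Real.exp (-(s * v t)) ≤ 1 / (1 + s * v t) := by
            rw [Real.exp_neg, ← one_div]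
            gcongr
            linarith [Real.add_one_le_exp (s * v t)]
          have h8 : s * v t / (1 + s * V) ≤ s * v t / (1 + s * v t) := by gcongr
          have h9 : s * v t / (1 + s * v t) = 1 - 1 / (1 + s * v t) := by field_simp; ring
          linarith
        calc (s / (2 * Real.pi * r * (1 + s * V))) * v t
            = 1 / (2 * Real.pi * r) * (s * v t / (1 + s * V)) := by field_simp
          _ ≤ K t * (1 - ‖f (t + δ * Complex.I)‖) := by
            refine mul_le_mul e1 e2 ?_ (hK0 t)
            have := hv0 t
            positivity
    rw [integral_const_mul] at h4
    have h5 := h4.trans h3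
    rw [div_mul_eq_mul_div, div_le_iff₀ (by positivity)] at h5
    have h6 : s * ∫ t in S, v t ≤ s * (2 * Real.pi * r * ((1 + s * V) * v0)) := by
      linarith
    exact le_of_mul_le_mul_left h6 hs
  rw [intervalIntegral.integral_of_le hle]
  have hlim : Tendsto (fun s : ℝ => 2 * Real.pi * r * ((1 + s * V) * v0)) (𝓝[>] 0)
      (𝓝 (2 * Real.pi * r * ((1 + 0 * V) * v0))) :=
    ((by fun_prop : Continuous fun s : ℝ => 2 * Real.pi * r * ((1 + s * V) * v0)).tendsto
      0).mono_left nhdsWithin_le_nhds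
  rw [zero_mul, add_zero, one_mul] at hlim
  exact ge_of_tendsto hlim (eventually_mem_nhdsWithin.mono fun s hs => key s hs)

/-- Cauchy's theorem on a rectangle, imaginary part. -/
lemma integral_im_sub_integral_im {M : ℂ → ℂ} (hM : DifferentiableOn ℂ M {w : ℂ | 0 < w.im})
    (a b : ℝ) {δ η : ℝ} (hδ : 0 < δ) (hη : 0 < η) :
    (∫ t in a..b, (M (t + η * Complex.I)).im) - (∫ t in a..b, (M (t + δ * Complex.I)).im) =
      ∫ y in δ..η, ((M (b + y * Complex.I)).re - (M (a + y * Complex.I)).re) := by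
  have key := Complex.integral_boundary_rect_eq_zero_of_differentiableOn M ⟨a, δ⟩ ⟨b, η⟩
    (hM.mono fun w hw => by
      have := hw.2
      rw [mem_preimage] at this
      have h2 := (le_inf hδ.le hη.le).trans this.1
      have h3 : 0 < min δ η := lt_min hδ hη
      exact lt_of_lt_of_le h3 this.1)
  simp only at key
  have hc : ∀ y : ℝ, 0 < y → IntervalIntegrable (fun t : ℝ => M (t + y * Complex.I)) volume a b :=
    fun y hy => (continuous_shift hM hy).intervalIntegrable _ _
  have hd : ∀ x : ℝ, IntervalIntegrable (fun y : ℝ => M (x + y * Complex.I)) volume δ η := by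
    intro x
    refine ContinuousOn.intervalIntegrable (hM.continuousOn.comp (by fun_prop) fun y hy => ?_)
    have h3 : 0 < min δ η := lt_min hδ hη
    simpa using lt_of_lt_of_le h3 hy.1
  have him : ∀ {a b : ℝ} {g : ℝ → ℂ}, IntervalIntegrable g volume a b →
      (∫ t in a..b, g t).im = ∫ t in a..b, (g t).im := fun {a b g} hg => by
    have := Complex.imCLM.intervalIntegral_comp_comm hg
    simpa using this.symm
  have hre : ∀ {a b : ℝ} {g : ℝ → ℂ}, IntervalIntegrable g volume a b →
      (∫ t in a..b, g t).re = ∫ t in a..b, (g t).re := fun {a b g} hg => by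
    have := Complex.reCLM.intervalIntegral_comp_comm hg
    simpa using this.symm
  have k2 := congrArg Complex.im key
  simp only [Complex.add_im, Complex.sub_im, smul_eq_mul, Complex.I_mul_im, Complex.zero_im] at k2
  rw [him (hc δ hδ), him (hc η hη), hre (hd a), hre (hd b)] at k2
  rw [intervalIntegral.integral_sub]
  · linarith
  all_goals
    refine ContinuousOn.intervalIntegrable (Complex.continuous_re.comp_continuousOn
      (hM.continuousOn.comp (by fun_prop) fun y hy => ?_))
    have h3 : 0 < min δ η := lt_min hδ hη
    simpa using lt_of_lt_of_le h3 hy.1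

lemma intervalIntegrable_of_tendsto {f : ℝ → ℝ} {L η : ℝ} (hη : 0 < η)
    (hf : ContinuousOn f (Ioi 0)) (hL : Tendsto f (𝓝[>] 0) (𝓝 L)) :
    IntervalIntegrable f volume 0 η := by
  -- The value of `f` at `0` is arbitrary and irrelevant to the integral; replacing it by the limit
  -- gives continuity on the closed interval.
  have h1 : ContinuousOn (Function.update f 0 L) (uIcc 0 η) := by
    rw [uIcc_of_le hη.le, continuousOn_update_iff]
    have hsub : Icc 0 η \ {0} ⊆ Ioi 0 := fun t ht => lt_of_le_of_ne ht.1.1 (Ne.symm ht.2)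
    exact ⟨hf.mono hsub, fun _ => hL.mono_left (nhdsWithin_mono _ hsub)⟩
  refine h1.intervalIntegrable.congr fun t ht => ?_
  rw [uIoc_of_le hη.le] at ht
  exact Function.update_of_ne ht.1.ne' _ _

/-- The mass between `a` and `b` of the boundary measure of the positive harmonic function
`Im M`. -/
def boundaryMass (M : ℂ → ℂ) (a b : ℝ) : ℝ :=
  (∫ t in a..b, (M (t + (1 : ℝ) * Complex.I)).im) -
    ∫ y in (0 : ℝ)..1, ((M (b + y * Complex.I)).re - (M (a + y * Complex.I)).re)

lemma continuousOn_vertical {M : ℂ → ℂ} (hM : DifferentiableOn ℂ M {w : ℂ | 0 < w.im}) (x : ℝ) :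
    ContinuousOn (fun y : ℝ => (M (x + y * Complex.I)).re) (Ioi 0) :=
  Complex.continuous_re.comp_continuousOn
    (hM.continuousOn.comp (by fun_prop) fun y hy => by simpa using hy)

lemma HasBoundaryValue.re {M : ℂ → ℂ} {x : ℝ} {w : ℂ} (h : HasBoundaryValue M x w) :
    Tendsto (fun y : ℝ => (M (x + y * Complex.I)).re) (𝓝[>] 0) (𝓝 w.re) :=
  (Complex.continuous_re.tendsto w).comp h

lemma HasBoundaryValue.im {M : ℂ → ℂ} {x : ℝ} {w : ℂ} (h : HasBoundaryValue M x w) :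
    Tendsto (fun y : ℝ => (M (x + y * Complex.I)).im) (𝓝[>] 0) (𝓝 w.im) :=
  (Complex.continuous_im.tendsto w).comp h

lemma HasBoundaryValue.intervalIntegrable {M : ℂ → ℂ} {x : ℝ} {w : ℂ}
    (h : HasBoundaryValue M x w) (hM : DifferentiableOn ℂ M {w : ℂ | 0 < w.im}) {η : ℝ}
    (hη : 0 < η) : IntervalIntegrable (fun y : ℝ => (M (x + y * Complex.I)).re) volume 0 η :=
  intervalIntegrable_of_tendsto hη (continuousOn_vertical hM x) h.re

/-- Cauchy's theorem on the rectangle between heights `δ` and `1`. The integrals over the vertical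
sides converge down to height `0` because both endpoints have finite boundary values, so the mass is
the limit as `δ → 0` of the horizontal integrals. -/
lemma integral_im_eq_boundaryMass_add {M : ℂ → ℂ} (hM : DifferentiableOn ℂ M {w : ℂ | 0 < w.im})
    {a b : ℝ} {wa wb : ℂ} (ha : HasBoundaryValue M a wa) (hb : HasBoundaryValue M b wb) {δ : ℝ}
    (hδ : 0 < δ) : ∫ t in a..b, (M (t + δ * Complex.I)).im = boundaryMass M a b +
      ∫ y in (0 : ℝ)..δ, ((M (b + y * Complex.I)).re - (M (a + y * Complex.I)).re) := by
  have h1 := integral_im_sub_integral_im hM a b hδ one_pos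
  have h2 := intervalIntegral.integral_interval_sub_left
    ((hb.intervalIntegrable hM one_pos).sub (ha.intervalIntegrable hM one_pos))
    ((hb.intervalIntegrable hM hδ).sub (ha.intervalIntegrable hM hδ))
  unfold boundaryMass
  linarith

lemma tendsto_integral_im {M : ℂ → ℂ} (hM : DifferentiableOn ℂ M {w : ℂ | 0 < w.im})
    {a b : ℝ} {wa wb : ℂ} (ha : HasBoundaryValue M a wa) (hb : HasBoundaryValue M b wb) :
    Tendsto (fun δ : ℝ => ∫ t in a..b, (M (t + δ * Complex.I)).im) (𝓝[>] 0)
      (𝓝 (boundaryMass M a b)) := by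
  have h1 := intervalIntegral.continuousOn_primitive_interval' (a := 0)
    ((hb.intervalIntegrable hM one_pos).sub (ha.intervalIntegrable hM one_pos)) left_mem_uIcc
  have h2 := (h1 0 left_mem_uIcc).tendsto
  rw [uIcc_of_le zero_le_one, intervalIntegral.integral_same] at h2
  have h3 := h2.mono_left (nhdsWithin_mono 0 Ioc_subset_Icc_self)
  rw [nhdsWithin_Ioc_eq_nhdsGT zero_lt_one] at h3
  have h4 := h3.const_add (boundaryMass M a b)
  rw [add_zero] at h4
  refine h4.congr' (eventually_mem_nhdsWithin.mono fun δ hδ => ?_)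
  exact (integral_im_eq_boundaryMass_add hM ha hb hδ).symm

lemma boundaryMass_nonneg {M : ℂ → ℂ} (hM : DifferentiableOn ℂ M {w : ℂ | 0 < w.im})
    (h0 : ∀ w : ℂ, 0 < w.im → 0 ≤ (M w).im)
    {a b : ℝ} (hab : a ≤ b) {wa wb : ℂ} (ha : HasBoundaryValue M a wa)
    (hb : HasBoundaryValue M b wb) : 0 ≤ boundaryMass M a b := by
  refine ge_of_tendsto (tendsto_integral_im hM ha hb) (eventually_mem_nhdsWithin.mono fun δ hδ => ?_)
  exact intervalIntegral.integral_nonneg hab fun t _ => h0 _ (by simpa using hδ)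

lemma boundaryMass_add {M : ℂ → ℂ} (hM : DifferentiableOn ℂ M {w : ℂ | 0 < w.im})
    {a b c : ℝ} {wa wb wc : ℂ} (ha : HasBoundaryValue M a wa)
    (hb : HasBoundaryValue M b wb) (hc : HasBoundaryValue M c wc) :
    boundaryMass M a b + boundaryMass M b c = boundaryMass M a c := by
  have hcont : Continuous fun t : ℝ => (M (t + (1 : ℝ) * Complex.I)).im :=
    Complex.continuous_im.comp (continuous_shift hM one_pos)
  unfold boundaryMass
  rw [← intervalIntegral.integral_add_adjacent_intervals (hcont.intervalIntegrable a b)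
    (hcont.intervalIntegrable b c)]
  have ia := ha.intervalIntegrable hM one_pos
  have ib := hb.intervalIntegrable hM one_pos
  have ic := hc.intervalIntegrable hM one_pos
  rw [intervalIntegral.integral_sub ib ia, intervalIntegral.integral_sub ic ib,
    intervalIntegral.integral_sub ic ia]
  ring

/-- The limit `δ → 0` of `integral_im_le`. Where the boundary value is real, the factor `Im M (x + i
r)` tends to `0`, so the mass near `x` is `o(r)`. -/
lemma boundaryMass_le {M : ℂ → ℂ} (hM : DifferentiableOn ℂ M {w : ℂ | 0 < w.im})
    (h0 : ∀ w : ℂ, 0 < w.im → 0 ≤ (M w).im) {x r : ℝ} (hr : 0 < r) {wa wb : ℂ}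
    (ha : HasBoundaryValue M (x - r) wa) (hb : HasBoundaryValue M (x + r) wb) :
    boundaryMass M (x - r) (x + r) ≤ 2 * Real.pi * r * (M (x + r * Complex.I)).im := by
  have hz : 0 < ((x : ℂ) + r * Complex.I).im := by simpa using hr
  have h1 := tendsto_add_heightSeq hM hz
  have h2 := ((Complex.continuous_im.tendsto _).comp h1).const_mul (2 * Real.pi * r)
  refine le_of_tendsto_of_tendsto' ((tendsto_integral_im hM ha hb).comp tendsto_heightSeq) h2
    fun k => ?_
  have := integral_im_le hM h0 x hr (heightSeq_pos k)
  simpa [add_mul, add_assoc] using this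

/-- A Herglotz function with finite real vertical boundary values at every point of an interval has
nondecreasing boundary values there. -/
theorem monotoneOn_boundaryValue {M : ℂ → ℂ} (hM : DifferentiableOn ℂ M {w : ℂ | 0 < w.im})
    (h0 : ∀ w : ℂ, 0 < w.im → 0 ≤ (M w).im) {a₀ b₀ : ℝ} {m : ℝ → ℂ}
    (hm : ∀ x ∈ Ioo a₀ b₀, HasBoundaryValue M x (m x) ∧ (m x).im = 0) :
    MonotoneOn (fun x => (m x).re) (Ioo a₀ b₀) := by
  have hadd : ∀ a ∈ Ioo a₀ b₀, ∀ b ∈ Ioo a₀ b₀, ∀ c ∈ Ioo a₀ b₀,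
      boundaryMass M a b + boundaryMass M b c = boundaryMass M a c := fun a ha b hb c hc =>
    boundaryMass_add hM (hm a ha).1 (hm b hb).1 (hm c hc).1
  have hnn : ∀ a ∈ Ioo a₀ b₀, ∀ b ∈ Ioo a₀ b₀, a ≤ b → 0 ≤ boundaryMass M a b :=
    fun a ha b hb hab => boundaryMass_nonneg hM h0 hab (hm a ha).1 (hm b hb).1
  have hzero : ∀ a ∈ Ioo a₀ b₀, ∀ b ∈ Ioo a₀ b₀, boundaryMass M a b = 0 := by
    intro a ha b hb
    -- An increment over a step `h` is at most the mass of `[x - |h|, x + |h|]`, hence at most `2 π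
    -- |h| Im M (x + i |h|) = o(h)`. A real boundary value is needed at every point, since a zero
    -- derivative a.e. would not exclude a singular measure.
    have hder : ∀ x ∈ Ioo a₀ b₀, HasDerivAt (boundaryMass M a) 0 x := by
      intro x hx
      rw [hasDerivAt_iff_isLittleO_nhds_zero]
      simp only [smul_zero, sub_zero]
      refine Asymptotics.IsLittleO.of_bound fun c hc => ?_
      have hlim : ∀ᶠ r : ℝ in 𝓝[>] 0, 2 * Real.pi * (M (x + r * Complex.I)).im < c := by
        have := (hm x hx).1.im.const_mul (2 * Real.pi)
        rw [(hm x hx).2, mul_zero] at this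
        exact this.eventually (gt_mem_nhds hc)
      obtain ⟨ε, hε, hεr⟩ := (mem_nhdsGT_iff_exists_Ioo_subset).1 hlim
      have hε0 : 0 < ε := hε
      have hη : 0 < min ε (min (x - a₀) (b₀ - x)) := by
        simp [hε0, hx.1, hx.2]
      filter_upwards [Metric.ball_mem_nhds (0 : ℝ) hη] with h hh
      rw [Metric.mem_ball, dist_zero_right, Real.norm_eq_abs, lt_min_iff, lt_min_iff] at hh
      obtain ⟨hh1, hh2, hh3⟩ := hh
      rw [Real.norm_eq_abs, Real.norm_eq_abs]
      rcases eq_or_ne h 0 with rfl | hne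
      · simp
      have hr : 0 < |h| := abs_pos.2 hne
      have hxp : x + |h| ∈ Ioo a₀ b₀ := ⟨by linarith, by linarith⟩
      have hxm : x - |h| ∈ Ioo a₀ b₀ := ⟨by linarith, by linarith⟩
      have hxh : x + h ∈ Ioo a₀ b₀ :=
        ⟨by linarith [neg_abs_le h], by linarith [le_abs_self h]⟩
      have e1 := hadd a ha x hx (x + h) hxh
      have e2 : |boundaryMass M x (x + h)| ≤ boundaryMass M (x - |h|) (x + |h|) := by
        have f1 := hadd _ hxm x hx _ hxp
        have f2 := hadd _ hxm _ hxh _ hxp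
        have f3 := hadd _ hxm x hx _ hxh
        have g1 := hnn _ hxm x hx (by linarith)
        have g2 := hnn _ hx _ hxp (by linarith)
        have g3 := hnn _ hxm _ hxh (by linarith [neg_abs_le h])
        have g4 := hnn _ hxh _ hxp (by linarith [le_abs_self h])
        rw [abs_le]
        constructor <;> linarith
      have e3 := boundaryMass_le hM h0 hr (hm _ hxm).1 (hm _ hxp).1
      have e4 : 2 * Real.pi * (M (x + |h| * Complex.I)).im < c := hεr ⟨hr, hh1⟩
      have e5 : boundaryMass M a (x + h) - boundaryMass M a x = boundaryMass M x (x + h) := by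
        linarith
      rw [e5]
      refine e2.trans (e3.trans ?_)
      nlinarith
    have := isOpen_Ioo.is_const_of_deriv_eq_zero isPreconnected_Ioo
      (fun x hx => (hder x hx).differentiableAt.differentiableWithinAt)
      (fun x hx => (hder x hx).deriv) hb ha
    rw [this]
    linarith [hadd a ha a ha a ha]
  -- With zero mass, the nonnegative integral of `Im M` at height `δ` equals the integral of `Re M
  -- (b + i y) - Re M (a + i y)` over `0 < y < δ`. If the boundary value at `b` were smaller than at
  -- `a`, that integrand would be negative for small `y`.
  intro a ha b hb hab
  by_contra hlt
  simp only [not_le] at hlt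
  have hab' : a ≤ b := hab
  have h1 : Tendsto (fun y : ℝ => (M (b + y * Complex.I)).re - (M (a + y * Complex.I)).re)
      (𝓝[>] 0) (𝓝 ((m b).re - (m a).re)) := (hm b hb).1.re.sub (hm a ha).1.re
  have h2 := h1.eventually (gt_mem_nhds (show (m b).re - (m a).re < 0 by linarith))
  obtain ⟨ε, hε, hεr⟩ := (mem_nhdsGT_iff_exists_Ioo_subset).1 h2
  have hε0 : 0 < ε := hε
  have hδ : 0 < ε / 2 := by positivity
  have h3 := integral_im_eq_boundaryMass_add hM (hm a ha).1 (hm b hb).1 hδ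
  have h4 : 0 ≤ ∫ t in a..b, (M (t + (ε / 2 : ℝ) * Complex.I)).im :=
    intervalIntegral.integral_nonneg hab' fun t _ => h0 _ (by simpa using hδ)
  have hii := ((hm b hb).1.intervalIntegrable hM hδ).sub ((hm a ha).1.intervalIntegrable hM hδ)
  have h5 : 0 < ∫ y in (0 : ℝ)..(ε / 2),
      -((M (b + y * Complex.I)).re - (M (a + y * Complex.I)).re) := by
    refine intervalIntegral.intervalIntegral_pos_of_pos_on hii.neg (fun y hy => ?_) hδ
    have : (M (b + y * Complex.I)).re - (M (a + y * Complex.I)).re < 0 :=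
      hεr ⟨hy.1, by linarith [hy.2]⟩
    linarith
  rw [intervalIntegral.integral_neg] at h5
  rw [hzero a ha b hb] at h3
  linarith

/-! ### Boundary values of logarithms -/

lemma abs_log_im_le_pi (z : ℂ) : |(Complex.log z).im| ≤ Real.pi := by
  rw [Complex.log_im]
  exact Complex.abs_arg_le_pi z

/-- On the negative axis the principal logarithm takes its limits from above, so the branch cut is
invisible from the closed upper half-plane. -/
lemma continuousWithinAt_log_upper {z : ℂ} (hz : z ≠ 0) :
    ContinuousWithinAt Complex.log {w : ℂ | 0 ≤ w.im} z := by
  by_cases hs : z ∈ Complex.slitPlane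
  · exact (continuousAt_clog hs).continuousWithinAt
  · rw [Complex.mem_slitPlane_iff] at hs
    push Not at hs
    refine Complex.continuousWithinAt_log_of_re_neg_of_im_zero (lt_of_le_of_ne hs.1 fun h => ?_) hs.2
    exact hz (Complex.ext h hs.2)

lemma tendsto_vertical (x : ℝ) : Tendsto (fun ε : ℝ => (x : ℂ) + ε * Complex.I) (𝓝[>] 0)
    (𝓝[{w : ℂ | 0 ≤ w.im}] (x : ℂ)) := by
  refine tendsto_nhdsWithin_iff.2 ⟨?_, eventually_mem_nhdsWithin.mono fun ε hε => ?_⟩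
  · have : Tendsto (fun ε : ℝ => (x : ℂ) + ε * Complex.I) (𝓝 0) (𝓝 ((x : ℂ) + (0 : ℝ) * Complex.I)) :=
      (by fun_prop : Continuous fun ε : ℝ => (x : ℂ) + ε * Complex.I).tendsto 0
    simp only [Complex.ofReal_zero, zero_mul, add_zero] at this
    exact this.mono_left nhdsWithin_le_nhds
  · have : (0 : ℝ) < ε := hε
    simpa using this.le

lemma tendsto_log_of_hasBoundaryValue {M : ℂ → ℂ} (h0 : ∀ w : ℂ, 0 < w.im → 0 ≤ (M w).im) {x : ℝ}
    {w : ℂ} (h : HasBoundaryValue M x w) (hw : w ≠ 0) :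
    Tendsto (fun ε : ℝ => (Complex.log (M (x + ε * Complex.I))).im) (𝓝[>] 0) (𝓝 w.arg) := by
  have h1 : ∀ᶠ ε : ℝ in 𝓝[>] 0, M (x + ε * Complex.I) ∈ {w : ℂ | 0 ≤ w.im} :=
    eventually_mem_nhdsWithin.mono fun ε hε => h0 _ (by simpa using hε)
  rw [← Complex.log_im]
  refine (Complex.continuous_im.tendsto _).comp ?_
  exact (continuousWithinAt_log_upper hw).tendsto.comp (tendsto_nhdsWithin_iff.2 ⟨h, h1⟩)

lemma tendsto_log_sub {x a : ℝ} (hxa : x ≠ a) :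
    Tendsto (fun ε : ℝ => (Complex.log (x + ε * Complex.I - a)).im) (𝓝[>] 0)
      (𝓝 (Real.pi * if x < a then 1 else 0)) := by
  have h := tendsto_log_of_hasBoundaryValue (M := fun z => z - a) (x := x) (w := x - a)
    (fun w hw => by simpa using hw.le)
    (((tendsto_vertical x).mono_right nhdsWithin_le_nhds).sub_const _)
    (by exact_mod_cast sub_ne_zero.2 hxa)
  convert h using 2
  rw [← Complex.ofReal_sub]
  split_ifs with hlt
  · rw [Complex.arg_ofReal_of_neg (by linarith), mul_one]
  · rw [Complex.arg_ofReal_of_nonneg (by linarith), mul_zero]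

/-! ### Position of bands and gaps, and the square root of `R` -/

section Bands

variable {n : ℕ} {E : ℕ → ℝ}

lemma edge_lt (hE : ∀ l : ℕ, l < 2 * n → E l < E (l + 1)) {i j : ℕ} (hij : i < j)
    (hj : j ≤ 2 * n) : E i < E j := by
  induction j, hij using Nat.le_induction with
  | base => exact hE i (by omega)
  | succ k hk ih => exact (ih (by omega)).trans (hE k (by omega))

lemma edge_le (hE : ∀ l : ℕ, l < 2 * n → E l < E (l + 1)) {i j : ℕ} (hij : i ≤ j)
    (hj : j ≤ 2 * n) : E i ≤ E j := by
  rcases hij.eq_or_lt with rfl | h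
  · exact le_rfl
  · exact (edge_lt hE h hj).le

lemma mem_bandSet {x : ℝ} : x ∈ bandSet n E ↔
    (∃ j < n, E (2 * j) ≤ x ∧ x ≤ E (2 * j + 1)) ∨ E (2 * n) ≤ x := by
  simp [bandSet]
  grind

lemma le_of_mem_bandSet (hE : ∀ l : ℕ, l < 2 * n → E l < E (l + 1)) {x : ℝ}
    (hx : x ∈ bandSet n E) : E 0 ≤ x := by
  rcases mem_bandSet.1 hx with ⟨j, hj, h1, -⟩ | h
  · exact (edge_le hE (Nat.zero_le _) (by omega)).trans h1
  · exact (edge_le hE (Nat.zero_le _) le_rfl).trans h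

lemma notMem_gap_of_mem_bandSet (hE : ∀ l : ℕ, l < 2 * n → E l < E (l + 1)) {x : ℝ}
    (hx : x ∈ bandSet n E) {k : ℕ} (hk : 1 ≤ k) (hkn : k ≤ n) :
    x ∉ Ioo (E (2 * k - 1)) (E (2 * k)) := by
  rintro ⟨hk1, hk2⟩
  rcases mem_bandSet.1 hx with ⟨j, hj, h1, h2⟩ | h
  · rcases lt_or_ge j k with hjk | hjk
    · have := edge_le hE (show 2 * j + 1 ≤ 2 * k - 1 by omega) (by omega)
      linarith
    · have := edge_le hE (show 2 * k ≤ 2 * j by omega) (by omega)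
      linarith
  · have := edge_le hE (show 2 * k ≤ 2 * n by omega) le_rfl
    linarith

lemma exists_gap_of_notMem_bandSet {x : ℝ} (hx : x ∉ bandSet n E) :
    x < E 0 ∨ ∃ k, 1 ≤ k ∧ k ≤ n ∧ x ∈ Ioo (E (2 * k - 1)) (E (2 * k)) := by
  rw [mem_bandSet] at hx
  push Not at hx
  obtain ⟨hx1, hx2⟩ := hx
  classical
  -- The least such `k` locates the gap: for `k = 0` the point is below all bands; otherwise `x ≥ E
  -- (2k - 2)`, and missing band `k - 1` forces `x > E (2k - 1)`.
  have hex : ∃ k, x < E (2 * k) := ⟨n, hx2⟩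
  have hspec := Nat.find_spec hex
  rcases Nat.eq_zero_or_pos (Nat.find hex) with h0 | hpos
  · left; rw [h0] at hspec; simpa using hspec
  · right
    have hle : Nat.find hex ≤ n := Nat.find_min' hex hx2
    have hmin := Nat.find_min hex (show Nat.find hex - 1 < Nat.find hex by omega)
    have := hx1 (Nat.find hex - 1) (by omega) (not_lt.1 hmin)
    rw [show 2 * (Nat.find hex - 1) + 1 = 2 * Nat.find hex - 1 by omega] at this
    exact ⟨_, hpos, hle, this, hspec⟩

lemma edge_mem_bandSet (hE : ∀ l : ℕ, l < 2 * n → E l < E (l + 1)) {l : ℕ} (hl : l ≤ 2 * n) :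
    E l ∈ bandSet n E := by
  by_contra h
  rcases exists_gap_of_notMem_bandSet h with h0 | ⟨k, hk, hkn, h1, h2⟩
  · exact absurd (edge_le hE (Nat.zero_le l) hl) (not_le.2 h0)
  · rcases le_or_gt l (2 * k - 1) with hlk | hlk
    · exact absurd (edge_le hE hlk (by omega)) (not_le.2 h1)
    · exact absurd (edge_le hE (show 2 * k ≤ l by omega) hl) (not_le.2 h2)

lemma sqrtProd_ne_zero {z : ℂ} (hz : ∀ l ≤ 2 * n, z ≠ E l) : sqrtProd n E z ≠ 0 := by
  refine Finset.prod_ne_zero_iff.2 fun l hl => ?_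
  rw [Finset.mem_range] at hl
  rw [Ne, Complex.cpow_eq_zero_iff]
  exact fun h => hz l (by omega) (sub_eq_zero.1 h.1)

lemma sqrtProd_ne_zero_of_im_pos {z : ℂ} (hz : 0 < z.im) : sqrtProd n E z ≠ 0 :=
  sqrtProd_ne_zero fun l _ h => by simp [h] at hz

lemma sqrtR_of_im_nonneg {z : ℂ} (hz : 0 ≤ z.im) : sqrtR n E z = sqrtProd n E z := if_pos hz

lemma sqrtR_conj {z : ℂ} (hz : 0 < z.im) : sqrtR n E (conj z) = -conj (sqrtProd n E z) := by
  rw [sqrtR, if_neg (by simpa using hz), Complex.conj_conj]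

lemma sqrtProd_eq_exp {z : ℂ} (hz : ∀ l ≤ 2 * n, z ≠ E l) : sqrtProd n E z =
    Complex.exp (1 / 2 * ∑ l ∈ Finset.range (2 * n + 1), Complex.log (z - E l)) := by
  rw [Finset.mul_sum, Complex.exp_sum, sqrtProd]
  refine Finset.prod_congr rfl fun l hl => ?_
  rw [Finset.mem_range] at hl
  rw [Complex.cpow_def_of_ne_zero (sub_ne_zero.2 (hz l (by omega))), mul_comm]

lemma continuousWithinAt_sqrtProd {z : ℂ} (hz : ∀ l ≤ 2 * n, z ≠ E l) :
    ContinuousWithinAt (sqrtProd n E) {w : ℂ | 0 ≤ w.im} z := by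
  refine tendsto_finsetProd _ fun l hl => ?_
  rw [Finset.mem_range] at hl
  have hne : z - E l ≠ 0 := sub_ne_zero.2 (hz l (by omega))
  have h1 : Tendsto (fun w : ℂ => w - E l) (𝓝[{w : ℂ | 0 ≤ w.im}] z)
      (𝓝[{w : ℂ | 0 ≤ w.im}] (z - E l)) := by
    refine tendsto_nhdsWithin_iff.2
      ⟨(tendsto_id.mono_left nhdsWithin_le_nhds).sub_const _, ?_⟩
    filter_upwards [self_mem_nhdsWithin] with w hw
    simpa using hw
  have h2 := (continuousWithinAt_log_upper hne).tendsto.comp h1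
  have h3 := (Complex.continuous_exp.tendsto _).comp (h2.mul_const (1 / 2 : ℂ))
  rw [Complex.cpow_def_of_ne_zero hne]
  refine h3.congr' ?_
  have h4 : ∀ᶠ w : ℂ in 𝓝[{w : ℂ | 0 ≤ w.im}] z, w ≠ E l :=
    nhdsWithin_le_nhds (isOpen_ne.mem_nhds (hz l (by omega)))
  filter_upwards [h4] with w hw
  rw [Complex.cpow_def_of_ne_zero (sub_ne_zero.2 hw)]
  rfl

lemma differentiableOn_sqrtProd : DifferentiableOn ℂ (sqrtProd n E) {w : ℂ | 0 < w.im} := by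
  unfold sqrtProd
  refine DifferentiableOn.fun_finsetProd fun l _ => ?_
  refine (differentiableOn_id.sub_const _).cpow_const fun w hw => Or.inr ?_
  have : 0 < w.im := hw
  simpa using this.ne'

/-- Groups the edges by gaps, leaving `E 0` alone, so that each gap can be compared with its own
zero. -/
lemma sum_range_two_mul_succ (f : ℕ → ℝ) (n : ℕ) : ∑ l ∈ Finset.range (2 * n + 1), f l =
    f 0 + ∑ j ∈ Finset.Icc 1 n, (f (2 * j - 1) + f (2 * j)) := by
  induction n with
  | zero => simp
  | succ k ih =>
    rw [Finset.sum_Icc_succ_top (by omega), show 2 * (k + 1) + 1 = 2 * k + 1 + 1 + 1 by ring,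
      Finset.sum_range_succ, Finset.sum_range_succ, ih,
      show 2 * (k + 1) - 1 = 2 * k + 1 by omega, show 2 * (k + 1) = 2 * k + 1 + 1 by ring]
    ring

/-! ### Recovering `M` from the argument of its boundary values -/

/-- The logarithm of `i ∏_{j ∈ S} (z - μ_j) / R(z)^{1/2}` in the upper half-plane. -/
def logQuotient (n : ℕ) (E μ : ℕ → ℝ) (S : Finset ℕ) (z : ℂ) : ℂ :=
  Real.pi / 2 * Complex.I + ∑ j ∈ S, Complex.log (z - μ j)
    - 1 / 2 * ∑ l ∈ Finset.range (2 * n + 1), Complex.log (z - E l)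

lemma exp_logQuotient {μ : ℕ → ℝ} {S : Finset ℕ} {z : ℂ} (hz : 0 < z.im) :
    Complex.exp (logQuotient n E μ S z) =
      Complex.I * (∏ j ∈ S, (z - μ j)) / sqrtProd n E z := by
  have hne : ∀ a : ℝ, z ≠ a := fun a h => by simp [h] at hz
  rw [logQuotient, Complex.exp_sub, Complex.exp_add, Complex.exp_pi_div_two_mul_I,
    ← sqrtProd_eq_exp fun l _ => hne _, Complex.exp_sum]
  congr 2
  exact Finset.prod_congr rfl fun j _ => Complex.exp_log (sub_ne_zero.2 (hne _))

lemma logQuotient_im (μ : ℕ → ℝ) (S : Finset ℕ) (z : ℂ) : (logQuotient n E μ S z).im =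
    Real.pi / 2 + ∑ j ∈ S, (Complex.log (z - μ j)).im
      - 1 / 2 * ∑ l ∈ Finset.range (2 * n + 1), (Complex.log (z - E l)).im := by
  have h1 : ∀ w : ℂ, (1 / 2 * w).im = 1 / 2 * w.im := fun w => by
    rw [show (1 / 2 : ℂ) = ((1 / 2 : ℝ) : ℂ) by push_cast; rfl, Complex.im_ofReal_mul]
  have h2 : ((Real.pi : ℂ) / 2 * Complex.I).im = Real.pi / 2 := by
    rw [show (Real.pi : ℂ) / 2 = ((Real.pi / 2 : ℝ) : ℂ) by push_cast; rfl, Complex.im_ofReal_mul,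
      Complex.I_im, mul_one]
  rw [logQuotient, Complex.sub_im, Complex.add_im, h1, h2, Complex.im_sum, Complex.im_sum]

/-- The function `M` is a multiple of `i ∏_{j ∈ S} (z - μ_j) / R(z)^{1/2}` if the arguments of the
boundary values agree almost everywhere. -/
theorem exists_eq_mul_of_arg_eq {M : ℂ → ℂ} (hM : DifferentiableOn ℂ M {w : ℂ | 0 < w.im})
    (h0 : ∀ w : ℂ, 0 < w.im → 0 < (M w).im) (μ : ℕ → ℝ) (S : Finset ℕ)
    (hbv : ∀ᵐ x : ℝ, ∃ w : ℂ, HasBoundaryValue M x w ∧ w ≠ 0 ∧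
      w.arg = Real.pi / 2 + ∑ j ∈ S, Real.pi * (if x < μ j then 1 else 0)
        - 1 / 2 * ∑ l ∈ Finset.range (2 * n + 1), Real.pi * (if x < E l then 1 else 0)) :
    ∃ c : ℝ, 0 < c ∧ ∀ z : ℂ, 0 < z.im →
      M z = Complex.I * (c * ∏ j ∈ S, (z - μ j)) / sqrtProd n E z := by
  set h : ℂ → ℂ := fun z => Complex.log (M z) - logQuotient n E μ S z with hhd
  have hlogd : ∀ a : ℝ, DifferentiableOn ℂ (fun z : ℂ => Complex.log (z - a)) {w : ℂ | 0 < w.im} :=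
    fun a => (differentiableOn_id.sub_const _).clog fun w hw => Or.inr (by
      have : 0 < w.im := hw
      simpa using this.ne')
  have hd : DifferentiableOn ℂ h {w : ℂ | 0 < w.im} := by
    refine (hM.clog fun w hw => Or.inr (h0 w hw).ne').sub (DifferentiableOn.sub ?_ ?_)
    · exact (differentiableOn_const _).add (DifferentiableOn.fun_sum fun j _ => hlogd _)
    · exact (DifferentiableOn.fun_sum fun l _ => hlogd _).const_mul _
  -- Every logarithm contributes an argument of size at most `π`; only boundedness is needed for
  -- uniqueness.
  have hb : ∀ w : ℂ, 0 < w.im → |(h w).im| ≤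
      Real.pi + (Real.pi / 2 + ∑ j ∈ S, Real.pi +
        1 / 2 * ∑ l ∈ Finset.range (2 * n + 1), Real.pi) := by
    intro w _
    rw [hhd, Complex.sub_im, logQuotient_im]
    refine (abs_sub _ _).trans (add_le_add (abs_log_im_le_pi _) ?_)
    refine (abs_sub _ _).trans (add_le_add ((abs_add_le _ _).trans (add_le_add ?_ ?_)) ?_)
    · rw [abs_of_pos (by positivity)]
    · exact (Finset.abs_sum_le_sum_abs _ _).trans
        (Finset.sum_le_sum fun j _ => abs_log_im_le_pi _)
    · rw [abs_mul, abs_of_pos (by norm_num : (0 : ℝ) < 1 / 2)]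
      gcongr
      exact (Finset.abs_sum_le_sum_abs _ _).trans
        (Finset.sum_le_sum fun j _ => abs_log_im_le_pi _)
  have hcount : ∀ᵐ x : ℝ, (∀ j, x ≠ μ j) ∧ ∀ l, x ≠ E l := by
    refine (ae_all_iff.2 fun j => ?_).and (ae_all_iff.2 fun l => ?_)
    · exact Measure.ae_ne volume (μ j)
    · exact Measure.ae_ne volume (E l)
  have him := fun (z : ℂ) (hz : 0 < z.im) => im_eq_zero_of_ae_tendsto hd hb (by
    filter_upwards [hbv, hcount] with x ⟨w, hw, hw0, harg⟩ ⟨hx1, hx2⟩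
    have t1 := tendsto_log_of_hasBoundaryValue (fun w hw => (h0 w hw).le) hw hw0
    have t2 : Tendsto (fun ε : ℝ => (logQuotient n E μ S (x + ε * Complex.I)).im) (𝓝[>] 0)
        (𝓝 w.arg) := by
      simp_rw [logQuotient_im, harg]
      refine Tendsto.sub (tendsto_const_nhds.add (tendsto_finsetSum _ fun j _ => ?_))
        ((tendsto_finsetSum _ fun l _ => ?_).const_mul _)
      · exact tendsto_log_sub (hx1 j)
      · exact tendsto_log_sub (hx2 l)
    simpa [hhd] using t1.sub t2) hz
  obtain ⟨c, hc⟩ := eq_const_of_im_eq_zero hd him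
  refine ⟨Real.exp c, Real.exp_pos c, fun z hz => ?_⟩
  have h1 : Complex.log (M z) = c + logQuotient n E μ S z := by
    rw [← hc z hz, hhd]; ring
  have hne : M z ≠ 0 := fun h => by simpa [h] using h0 z hz
  rw [← Complex.exp_log hne, h1, Complex.exp_add, exp_logQuotient hz, Complex.ofReal_exp]
  ring

end Bands

variable {n : ℕ} {E : ℕ → ℝ}

/-- A representation of a Herglotz function in the upper half-plane extends to `ℂ \ Σ_n`. -/
theorem eq_on_offBands (hE : ∀ l : ℕ, l < 2 * n → E l < E (l + 1)) {M : ℂ → ℂ}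
    (hM : IsHerglotz M) (F : Polynomial ℝ)
    (hbv : ∀ x : ℝ, x ∉ bandSet n E → HasBoundaryValue M x (M x))
    (hup : ∀ z : ℂ, 0 < z.im → M z = Complex.I * Polynomial.aeval z F / sqrtProd n E z) :
    ∀ z ∈ offBands n E, M z = Complex.I * Polynomial.aeval z F / sqrtR n E z := by
  intro z hz
  rcases lt_trichotomy 0 z.im with him | him | him
  · rw [hup z him, sqrtR_of_im_nonneg him.le]
  · obtain ⟨x, rfl⟩ : ∃ x : ℝ, (x : ℂ) = z := ⟨z.re, Complex.ext rfl (by simpa using him)⟩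
    have hx : x ∉ bandSet n E := fun h => hz ⟨x, h, rfl⟩
    have hne : ∀ l ≤ 2 * n, (x : ℂ) ≠ E l := fun l hl h => hx (by
      rw [Complex.ofReal_injective h]
      exact edge_mem_bandSet hE hl)
    rw [sqrtR_of_im_nonneg (by simp)]
    refine tendsto_nhds_unique (hbv x hx) ?_
    have hF : ContinuousWithinAt (fun w : ℂ => Complex.I * Polynomial.aeval w F)
        {w : ℂ | 0 ≤ w.im} (x : ℂ) :=
      (continuous_const.mul (Polynomial.continuous_aeval F)).continuousWithinAt
    have h1 := (hF.div (continuousWithinAt_sqrtProd hne)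
      (sqrtProd_ne_zero hne)).tendsto.comp (tendsto_vertical x)
    refine h1.congr' (eventually_mem_nhdsWithin.mono fun ε hε => ?_)
    exact (hup _ (by simpa using hε)).symm
  · obtain ⟨w, hw, rfl⟩ : ∃ w : ℂ, 0 < w.im ∧ conj w = z :=
      ⟨conj z, by simpa using him, Complex.conj_conj z⟩
    rw [hM.symm w hw, hup w hw, sqrtR_conj hw, Polynomial.aeval_conj, map_div₀, map_mul,
      Complex.conj_I, div_neg, neg_mul, neg_div]

/-! ### Zeros in the gaps and the two polynomial forms -/

/-- The nondecreasing function `m` changes sign at some point of the closed interval. -/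
lemma exists_sign_change {a b : ℝ} (hab : a ≤ b) {m : ℝ → ℝ} (hm : MonotoneOn m (Ioo a b)) :
    ∃ μ ∈ Icc a b, ∀ x ∈ Ioo a b, (x < μ → m x ≤ 0) ∧ (μ < x → 0 ≤ m x) := by
  -- Inserting `a` keeps the set nonempty, so the supremum is `a` when `m` is nowhere negative; it
  -- is `b` when `m` is negative throughout.
  set A : Set ℝ := insert a {x ∈ Ioo a b | m x < 0} with hA
  have hne : A.Nonempty := ⟨a, mem_insert _ _⟩
  have hub : b ∈ upperBounds A := by
    rintro x (rfl | hx)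
    · exact hab
    · exact hx.1.2.le
  refine ⟨sSup A, ⟨le_csSup ⟨b, hub⟩ (mem_insert _ _), csSup_le hne hub⟩, fun x hx => ⟨?_, ?_⟩⟩
  · intro hlt
    obtain ⟨y, hy, hxy⟩ := exists_lt_of_lt_csSup hne hlt
    rcases hy with rfl | hy
    · exact absurd hxy (not_lt.2 hx.1.le)
    · exact (hm hx hy.1 hxy.le).trans hy.2.le
  · intro hlt
    by_contra hneg
    exact absurd (le_csSup ⟨b, hub⟩ (mem_insert_of_mem a ⟨hx, not_le.1 hneg⟩)) (not_le.2 hlt)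

/-- The polynomial `c ∏_{j ∈ S} (X - μ_j)`. -/
def rootPoly (c : ℝ) (S : Finset ℕ) (μ : ℕ → ℝ) : Polynomial ℝ :=
  Polynomial.C c * ∏ j ∈ S, (Polynomial.X - Polynomial.C (μ j))

lemma natDegree_rootPoly {c : ℝ} (hc : c ≠ 0) (S : Finset ℕ) (μ : ℕ → ℝ) :
    (rootPoly c S μ).natDegree = S.card := by
  rw [rootPoly, Polynomial.natDegree_C_mul hc, Polynomial.natDegree_finsetProd_X_sub_C_eq_card]

lemma eval_rootPoly (c : ℝ) (S : Finset ℕ) (μ : ℕ → ℝ) (x : ℝ) :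
    (rootPoly c S μ).eval x = c * ∏ j ∈ S, (x - μ j) := by
  simp [rootPoly, Polynomial.eval_prod]

lemma aeval_rootPoly (c : ℝ) (S : Finset ℕ) (μ : ℕ → ℝ) (z : ℂ) :
    Polynomial.aeval z (rootPoly c S μ) = c * ∏ j ∈ S, (z - μ j) := by
  simp [rootPoly]

lemma oneZeroIn_rootPoly {c : ℝ} (hc : c ≠ 0) {S : Finset ℕ} {μ : ℕ → ℝ} {s : Set ℝ} {k : ℕ}
    (hk : k ∈ S) (hs : μ k ∈ s) (huniq : ∀ j ∈ S, μ j ∈ s → j = k) :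
    OneZeroIn (rootPoly c S μ) s := by
  refine ⟨μ k, ⟨hs, ?_⟩, fun x hx => ?_⟩
  · rw [Polynomial.IsRoot, eval_rootPoly, Finset.prod_eq_zero hk (sub_self _), mul_zero]
  · have h := hx.2
    rw [Polynomial.IsRoot, eval_rootPoly, mul_eq_zero, Finset.prod_eq_zero_iff] at h
    obtain ⟨j, hj, hxj⟩ := h.resolve_left hc
    have hxj : x = μ j := sub_eq_zero.1 hxj
    rw [hxj, huniq j hj (hxj ▸ hx.1)]

/-- The value of the argument on the bands and in the gaps, for zeros `μ_j` in the closed gaps. -/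
lemma arg_sum_eq (μ : ℕ → ℝ) (x : ℝ) (T : Finset ℕ) (hT : Disjoint T (Finset.Icc 1 n)) :
    Real.pi / 2 + ∑ j ∈ T ∪ Finset.Icc 1 n, Real.pi * (if x < μ j then 1 else 0)
        - 1 / 2 * ∑ l ∈ Finset.range (2 * n + 1), Real.pi * (if x < E l then 1 else 0) =
    (Real.pi / 2 + ∑ j ∈ T, Real.pi * (if x < μ j then 1 else 0)
      - Real.pi / 2 * if x < E 0 then 1 else 0) +
    ∑ j ∈ Finset.Icc 1 n, Real.pi * ((if x < μ j then 1 else 0)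
      - 1 / 2 * ((if x < E (2 * j - 1) then 1 else 0) + if x < E (2 * j) then 1 else 0)) := by
  rw [sum_range_two_mul_succ, Finset.sum_union hT]
  simp_rw [mul_sub, Finset.sum_sub_distrib]
  rw [mul_add (1 / 2 : ℝ), Finset.mul_sum]
  have : ∀ j, 1 / 2 * (Real.pi * (if x < E (2 * j - 1) then (1 : ℝ) else 0) +
        Real.pi * if x < E (2 * j) then 1 else 0) =
      Real.pi * (1 / 2 * ((if x < E (2 * j - 1) then (1 : ℝ) else 0)
        + if x < E (2 * j) then 1 else 0)) := fun j => by ring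
  simp_rw [this]
  ring

/-- Seen from outside a gap, its zero lies on the same side as both its edges: one full jump of `π`
from the zero cancels two half jumps from the edges. -/
lemma gap_term_eq_zero (hE : ∀ l : ℕ, l < 2 * n → E l < E (l + 1)) {μ : ℕ → ℝ} {x : ℝ} {j : ℕ}
    (hj : 1 ≤ j) (hjn : j ≤ n) (hμ : μ j ∈ Icc (E (2 * j - 1)) (E (2 * j)))
    (hx : x ∉ Ioo (E (2 * j - 1)) (E (2 * j))) (hxE : ∀ l, x ≠ E l) :
    Real.pi * ((if x < μ j then 1 else 0)
      - 1 / 2 * ((if x < E (2 * j - 1) then 1 else 0) + if x < E (2 * j) then 1 else 0)) = 0 := by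
  have hlt := edge_lt hE (show 2 * j - 1 < 2 * j by omega) (by omega)
  rcases lt_or_gt_of_ne (hxE (2 * j - 1)) with h | h
  · rw [if_pos (h.trans_le hμ.1), if_pos h, if_pos (h.trans hlt)]
    ring
  · have h2 : E (2 * j) ≤ x := by
      by_contra h3
      exact hx ⟨h, not_le.1 h3⟩
    rw [if_neg (not_lt.2 (hμ.2.trans h2)), if_neg (not_lt.2 h.le), if_neg (not_lt.2 h2)]
    ring

/-- The index `0` is reserved for a possible zero in `(-∞, E 0]`, so that `T = ∅` and `T = {0}` give
the two alternatives by one argument. In each region at most one gap term survives, and the sum is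
compared with the argument of `M`. -/
lemma exists_representation (hE : ∀ l : ℕ, l < 2 * n → E l < E (l + 1)) {M : ℂ → ℂ}
    (hM : IsHerglotz M) (h0 : ∀ w : ℂ, 0 < w.im → 0 < (M w).im)
    (hband : ∀ᵐ x : ℝ, x ∈ bandSet n E → ∃ y : ℝ, HasBoundaryValue M x ((y : ℂ) * Complex.I))
    (hgap : ∀ x : ℝ, x ∉ bandSet n E → HasBoundaryValue M x (M x) ∧ (M x).im = 0)
    {μ : ℕ → ℝ} {T : Finset ℕ} (hT : T ⊆ {0})
    (hμ : ∀ j, 1 ≤ j → j ≤ n → μ j ∈ Icc (E (2 * j - 1)) (E (2 * j)) ∧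
      ∀ x ∈ Ioo (E (2 * j - 1)) (E (2 * j)), (x < μ j → (M x).re ≤ 0) ∧ (μ j < x → 0 ≤ (M x).re))
    (hμ0 : ∀ j ∈ T, μ j ≤ E 0)
    (hlow : ∀ x < E 0, (∀ j, x ≠ μ j) → M x ≠ 0 → (M x).arg =
      ∑ j ∈ T, Real.pi * (if x < μ j then 1 else 0)) :
    ∃ c : ℝ, 0 < c ∧ ∀ z : ℂ, 0 < z.im → M z = Complex.I *
      Polynomial.aeval z (rootPoly c (T ∪ Finset.Icc 1 n) μ) / sqrtProd n E z := by
  simp_rw [aeval_rootPoly]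
  have hcount : ∀ᵐ x : ℝ, (∀ j, x ≠ μ j) ∧ ∀ l, x ≠ E l :=
    (ae_all_iff.2 fun j => Measure.ae_ne volume (μ j)).and
      (ae_all_iff.2 fun l => Measure.ae_ne volume (E l))
  have hdisj : Disjoint T (Finset.Icc 1 n) := by
    refine Finset.disjoint_left.2 fun j hj hj2 => ?_
    have h1 := Finset.mem_singleton.1 (hT hj)
    have h2 := (Finset.mem_Icc.1 hj2).1
    omega
  refine exists_eq_mul_of_arg_eq hM.analytic h0 μ _ ?_
  filter_upwards [hband, hcount, ae_not_hasBoundaryValue_zero hM.analytic h0]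
    with x hxb ⟨hxμ, hxE⟩ hnz
  rw [arg_sum_eq μ x T hdisj]
  by_cases hx : x ∈ bandSet n E
  · obtain ⟨y, hy⟩ := hxb hx
    have hy0 : y ≠ 0 := by
      rintro rfl
      simp only [Complex.ofReal_zero, zero_mul] at hy
      exact hnz hy
    have hypos : 0 < y := by
      have h1 : 0 ≤ ((y : ℂ) * Complex.I).im := ge_of_tendsto hy.im
        (eventually_mem_nhdsWithin.mono fun ε hε => (h0 _ (by simpa using hε)).le)
      exact lt_of_le_of_ne (by simpa using h1) hy0.symm
    refine ⟨_, hy, by simp [hy0], ?_⟩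
    have hE0 := le_of_mem_bandSet hE hx
    rw [Complex.arg_real_mul _ hypos, Complex.arg_I, if_neg (not_lt.2 hE0),
      Finset.sum_eq_zero (s := T) fun j hj => ?_,
      Finset.sum_eq_zero (s := Finset.Icc 1 n) fun j hj => ?_]
    · ring
    · obtain ⟨hj1, hj2⟩ := Finset.mem_Icc.1 hj
      exact gap_term_eq_zero hE hj1 hj2 (hμ j hj1 hj2).1
        (notMem_gap_of_mem_bandSet hE hx hj1 hj2) hxE
    · rw [if_neg (not_lt.2 ((hμ0 j hj).trans hE0)), mul_zero]
  · have hbv := (hgap x hx).1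
    have hre : M x = ((M x).re : ℂ) := Complex.ext (by simp) (by simpa using (hgap x hx).2)
    have hne : M x ≠ 0 := fun h => hnz (h ▸ hbv)
    refine ⟨_, hbv, hne, ?_⟩
    rcases exists_gap_of_notMem_bandSet hx with hlt | ⟨k, hk, hkn, hxk⟩
    · rw [if_pos hlt, hlow x hlt hxμ hne, Finset.sum_eq_zero (s := Finset.Icc 1 n) fun j hj => ?_]
      · ring
      · obtain ⟨hj1, hj2⟩ := Finset.mem_Icc.1 hj
        refine gap_term_eq_zero hE hj1 hj2 (hμ j hj1 hj2).1 (fun h => ?_) hxE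
        have := edge_le hE (Nat.zero_le (2 * j - 1)) (by omega)
        linarith [h.1]
    · have hE0 : E 0 ≤ x := (edge_le hE (Nat.zero_le (2 * k - 1)) (by omega)).trans hxk.1.le
      -- In gap `k` only the term of `k` remains: `π / 2 - π / 2 = 0` to the right of `μ k`, and `π
      -- / 2 + π / 2 = π` to the left.
      rw [if_neg (not_lt.2 hE0), Finset.sum_eq_zero (s := T) fun j hj => by
          rw [if_neg (not_lt.2 ((hμ0 j hj).trans hE0)), mul_zero],
        Finset.sum_eq_single_of_mem k (Finset.mem_Icc.2 ⟨hk, hkn⟩) fun j hj hjk => ?_]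
      · rw [if_neg (not_lt.2 hxk.1.le), if_pos hxk.2]
        have hre0 : (M x).re ≠ 0 := fun h => hne (by rw [hre, h, Complex.ofReal_zero])
        rw [hre]
        rcases lt_or_gt_of_ne (hxμ k) with h | h
        · rw [if_pos h, Complex.arg_ofReal_of_neg
            (lt_of_le_of_ne (((hμ k hk hkn).2 x hxk).1 h) hre0)]
          ring
        · rw [if_neg (not_lt.2 h.le), Complex.arg_ofReal_of_nonneg (((hμ k hk hkn).2 x hxk).2 h)]
          ring
      · obtain ⟨hj1, hj2⟩ := Finset.mem_Icc.1 hj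
        refine gap_term_eq_zero hE hj1 hj2 (hμ j hj1 hj2).1 (fun h => ?_) hxE
        rcases lt_or_gt_of_ne hjk with hl | hl
        · have := edge_le hE (show 2 * j ≤ 2 * k - 1 by omega) (by omega)
          linarith [h.2, hxk.1]
        · have := edge_le hE (show 2 * k ≤ 2 * j - 1 by omega) (by omega)
          linarith [h.1, hxk.2]

/-- In the upper half-plane `R^{1/2}` has no zero and cancels; agreement at the points `k + i` then
determines the polynomial. Comparing degrees makes the two alternatives exclusive. -/
lemma aeval_eq_of_quotient_eq {F H : Polynomial ℝ}
    (h : ∀ z ∈ offBands n E, Complex.I * Polynomial.aeval z F / sqrtR n E z =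
      Complex.I * Polynomial.aeval z H / sqrtR n E z) : F = H := by
  have hz : ∀ z : ℂ, 0 < z.im → Polynomial.aeval z F = Polynomial.aeval z H := fun z hz => by
    have h1 := h z (by
      rintro ⟨x, -, rfl⟩
      simp at hz)
    rw [sqrtR_of_im_nonneg hz.le] at h1
    have h2 := (div_left_inj' (sqrtProd_ne_zero_of_im_pos hz)).1 h1
    exact mul_left_cancel₀ Complex.I_ne_zero h2
  refine Polynomial.map_injective (algebraMap ℝ ℂ) (algebraMap ℝ ℂ).injective
    (Polynomial.eq_of_infinite_eval_eq _ _ (Set.Infinite.mono (s := range fun k : ℕ =>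
      ((k : ℂ) + Complex.I)) ?_ (infinite_range_of_injective fun a b hab => ?_)))
  · rintro _ ⟨k, rfl⟩
    rw [mem_ofPred_eq, Polynomial.eval_map_algebraMap, Polynomial.eval_map_algebraMap]
    exact hz _ (by simp)
  · exact_mod_cast add_right_cancel hab

theorem herglotz_form (hE : ∀ l : ℕ, l < 2 * n → E l < E (l + 1)) {M : ℂ → ℂ}
    (hM : IsHerglotz M) (hnz : ∃ z : ℂ, 0 < z.im ∧ M z ≠ 0)
    (hband : ∀ᵐ x : ℝ, x ∈ bandSet n E → ∃ y : ℝ, HasBoundaryValue M x ((y : ℂ) * Complex.I))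
    (hgap : ∀ x : ℝ, x ∉ bandSet n E → HasBoundaryValue M x (M x) ∧ (M x).im = 0) :
    Xor
      (∃ F : Polynomial ℝ, F.natDegree = n ∧ (∀ x : ℝ, E (2 * n) < x → 0 < F.eval x) ∧
        (∀ j : ℕ, 1 ≤ j → j ≤ n → OneZeroIn F (Set.Icc (E (2 * j - 1)) (E (2 * j)))) ∧
        ∀ z ∈ offBands n E, M z = Complex.I * Polynomial.aeval z F / sqrtR n E z)
      (∃ H : Polynomial ℝ, H.natDegree = n + 1 ∧ (∀ x : ℝ, E (2 * n) < x → 0 < H.eval x) ∧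
        OneZeroIn H (Set.Iic (E 0)) ∧
        (∀ j : ℕ, 1 ≤ j → j ≤ n → OneZeroIn H (Set.Icc (E (2 * j - 1)) (E (2 * j)))) ∧
        ∀ z ∈ offBands n E, M z = Complex.I * Polynomial.aeval z H / sqrtR n E z) := by
  have h0 : ∀ w : ℂ, 0 < w.im → 0 < (M w).im := by
    refine (im_pos_or_eq_const hM.analytic hM.im_nonneg).resolve_right ?_
    rintro ⟨c, hc⟩
    obtain ⟨z, hz, hz0⟩ := hnz
    have hc0 : c ≠ 0 := by
      rintro rfl
      exact hz0 (by simpa using hc z hz)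
    -- A nonzero real constant has no imaginary boundary value, so the unbounded band would be a
    -- null set.
    have hae : ∀ᵐ x : ℝ, x ∉ Ioi (E (2 * n)) := by
      filter_upwards [hband] with x hx hxE
      obtain ⟨y, hy⟩ := hx (mem_bandSet.2 (Or.inr (le_of_lt hxE)))
      have h1 : HasBoundaryValue M x c := tendsto_const_nhds.congr'
        (eventually_mem_nhdsWithin.mono fun ε hε => (hc _ (by simpa using hε)).symm)
      have h2 := congrArg Complex.re (tendsto_nhds_unique hy h1)
      simp at h2
      exact hc0 h2.symm
    have := measure_eq_zero_iff_ae_notMem.2 hae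
    simp at this
  have hmono : ∀ a b : ℝ, (∀ x ∈ Ioo a b, x ∉ bandSet n E) →
      MonotoneOn (fun x : ℝ => (M x).re) (Ioo a b) := fun a b hab =>
    monotoneOn_boundaryValue (m := fun x : ℝ => M x) hM.analytic hM.im_nonneg
      fun x hx => hgap x (hab x hx)
  have hgapm : ∀ j, 1 ≤ j → j ≤ n → ∃ μ : ℝ, μ ∈ Icc (E (2 * j - 1)) (E (2 * j)) ∧
      ∀ x ∈ Ioo (E (2 * j - 1)) (E (2 * j)), (x < μ → (M x).re ≤ 0) ∧ (μ < x → 0 ≤ (M x).re) :=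
    fun j hj hjn => exists_sign_change (edge_le hE (by omega) (by omega))
      (hmono _ _ fun x hx hxb => notMem_gap_of_mem_bandSet hE hxb hj hjn hx)
  have hlowb : ∀ x < E 0, x ∉ bandSet n E := fun x hx hxb =>
    absurd (le_of_mem_bandSet hE hxb) (not_le.2 hx)
  choose! μ hμ using hgapm
  -- Closed gaps are separated by nondegenerate bands, so a zero of one gap never lies in another,
  -- even at an edge.
  have hord : ∀ ν : ℕ → ℝ, (∀ j, 1 ≤ j → j ≤ n → ν j ∈ Icc (E (2 * j - 1)) (E (2 * j))) →
      ∀ k, 1 ≤ k → k ≤ n → ∀ j, 1 ≤ j → j ≤ n → ν j ∈ Icc (E (2 * k - 1)) (E (2 * k)) → j = k := by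
    intro ν hν k hk hkn j hj hjn hjk
    have h1 := hν j hj hjn
    rcases lt_trichotomy j k with h | h | h
    · have := edge_lt hE (show 2 * j < 2 * k - 1 by omega) (by omega)
      linarith [h1.2, hjk.1]
    · exact h
    · have := edge_lt hE (show 2 * k < 2 * j - 1 by omega) (by omega)
      linarith [h1.1, hjk.2]
  have hreal : ∀ x < E 0, M x = ((M x).re : ℂ) := fun x hx =>
    Complex.ext (by simp) (by simpa using (hgap x (hlowb x hx)).2)
  have hexcl : ∀ F H : Polynomial ℝ, F.natDegree = n → H.natDegree = n + 1 →
      (∀ z ∈ offBands n E, M z = Complex.I * Polynomial.aeval z F / sqrtR n E z) →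
      ¬ ∀ z ∈ offBands n E, M z = Complex.I * Polynomial.aeval z H / sqrtR n E z := by
    intro F H hF hH h1 h2
    have h3 : F = H := aeval_eq_of_quotient_eq fun z hz => (h1 z hz).symm.trans (h2 z hz)
    rw [h3, hH] at hF
    omega
  have hpos : ∀ (c : ℝ) (S : Finset ℕ) (ν : ℕ → ℝ), 0 < c → (∀ j ∈ S, ν j ≤ E (2 * n)) →
      ∀ x : ℝ, E (2 * n) < x → 0 < (rootPoly c S ν).eval x := fun c S ν hc hν x hx => by
    rw [eval_rootPoly]
    exact mul_pos hc (Finset.prod_pos fun j hj => by linarith [hν j hj])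
  by_cases hsign : ∀ x < E 0, 0 ≤ (M x).re
  · obtain ⟨c, hc, hrep⟩ := exists_representation hE hM h0 hband hgap (T := ∅) (by simp) hμ
      (by simp) (fun x hx _ _ => by
        rw [hreal x hx, Complex.arg_ofReal_of_nonneg (hsign x hx), Finset.sum_empty])
    rw [Finset.empty_union] at hrep
    have hform := eq_on_offBands hE hM _ (fun x hx => (hgap x hx).1) hrep
    have hdeg : (rootPoly c (Finset.Icc 1 n) μ).natDegree = n := by
      rw [natDegree_rootPoly hc.ne']; simp
    refine Or.inl ⟨⟨_, hdeg, hpos _ _ _ hc fun j hj => ?_, fun k hk hkn => ?_, hform⟩, ?_⟩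
    · obtain ⟨hj1, hj2⟩ := Finset.mem_Icc.1 hj
      exact (hμ j hj1 hj2).1.2.trans (edge_le hE (by omega) le_rfl)
    · exact oneZeroIn_rootPoly hc.ne' (Finset.mem_Icc.2 ⟨hk, hkn⟩) (hμ k hk hkn).1 fun j hj hjk =>
        hord μ (fun j hj hjn => (hμ j hj hjn).1) k hk hkn j (Finset.mem_Icc.1 hj).1
          (Finset.mem_Icc.1 hj).2 hjk
    · rintro ⟨H, hH, -, -, -, hHf⟩
      exact hexcl _ H hdeg hH hform hHf
  · push Not at hsign
    obtain ⟨x₁, hx₁, hneg⟩ := hsign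
    -- A bounded interval suffices: to the left of `x₁` monotonicity already gives `M ≤ M x₁ < 0`.
    -- The left end `x₁ - 1` only makes `x₁` an interior point.
    obtain ⟨ν₀, hν₀, hsgn⟩ := exists_sign_change (a := x₁ - 1) (b := E 0) (by linarith)
      (hmono _ _ fun x hx => hlowb x hx.2)
    set ν : ℕ → ℝ := Function.update μ 0 ν₀ with hν
    have hν0 : ν 0 = ν₀ := Function.update_self _ _ _
    have hνj : ∀ j, 1 ≤ j → ν j = μ j := fun j hj => Function.update_of_ne (by omega) _ _
    have hνμ : ∀ j, 1 ≤ j → j ≤ n → ν j ∈ Icc (E (2 * j - 1)) (E (2 * j)) ∧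
        ∀ x ∈ Ioo (E (2 * j - 1)) (E (2 * j)),
          (x < ν j → (M x).re ≤ 0) ∧ (ν j < x → 0 ≤ (M x).re) := fun j hj hjn => by
      rw [hνj j hj]; exact hμ j hj hjn
    obtain ⟨c, hc, hrep⟩ := exists_representation hE hM h0 hband hgap (T := {0}) (μ := ν)
      (by simp) hνμ (by simpa [hν0] using hν₀.2) (fun x hx hxν hne => by
        have hre0 : (M x).re ≠ 0 := fun h => hne (by rw [hreal x hx, h, Complex.ofReal_zero])
        have hx0 := hxν 0
        rw [Finset.sum_singleton, hreal x hx, hν0]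
        rw [hν0] at hx0
        rcases lt_or_gt_of_ne hx0 with h | h
        · rw [if_pos h, mul_one, Complex.arg_ofReal_of_neg]
          refine lt_of_le_of_ne ?_ hre0
          by_cases hx1 : x₁ - 1 < x
          · exact (hsgn x ⟨hx1, hx⟩).1 h
          · have := hmono (x - 1) (E 0) (fun x hx => hlowb x hx.2)
              (show x ∈ Ioo (x - 1) (E 0) from ⟨by linarith, hx⟩)
              (show x₁ ∈ Ioo (x - 1) (E 0) from ⟨by linarith, hx₁⟩) (by linarith)
            exact le_trans this hneg.le
        · rw [if_neg (not_lt.2 h.le), mul_zero, Complex.arg_ofReal_of_nonneg]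
          exact (hsgn x ⟨by linarith [hν₀.1], hx⟩).2 h)
    have hform := eq_on_offBands hE hM _ (fun x hx => (hgap x hx).1) hrep
    have hmem : ∀ j, j ∈ ({0} ∪ Finset.Icc 1 n : Finset ℕ) ↔ j = 0 ∨ (1 ≤ j ∧ j ≤ n) := by simp
    have hdeg : (rootPoly c ({0} ∪ Finset.Icc 1 n) ν).natDegree = n + 1 := by
      rw [natDegree_rootPoly hc.ne', Finset.card_union_of_disjoint (by simp)]
      simp [add_comm]
    refine Or.inr ⟨⟨_, hdeg, hpos _ _ _ hc fun j hj => ?_, ?_, fun k hk hkn => ?_, hform⟩, ?_⟩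
    · rcases (hmem j).1 hj with rfl | ⟨hj1, hj2⟩
      · rw [hν0]
        exact hν₀.2.trans (edge_le hE (Nat.zero_le _) le_rfl)
      · exact (hνμ j hj1 hj2).1.2.trans (edge_le hE (by omega) le_rfl)
    · refine oneZeroIn_rootPoly hc.ne' ((hmem 0).2 (Or.inl rfl)) (by rw [hν0]; exact hν₀.2)
        fun j hj hj0 => ?_
      rcases (hmem j).1 hj with rfl | ⟨hj1, hj2⟩
      · rfl
      · have h1 := edge_lt hE (show 0 < 2 * j - 1 by omega) (by omega)
        have h2 : ν j ≤ E 0 := hj0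
        linarith [(hνμ j hj1 hj2).1.1]
    · refine oneZeroIn_rootPoly hc.ne' ((hmem k).2 (Or.inr ⟨hk, hkn⟩)) (hνμ k hk hkn).1
        fun j hj hjk => ?_
      rcases (hmem j).1 hj with rfl | ⟨hj1, hj2⟩
      · have h1 := edge_lt hE (show 0 < 2 * k - 1 by omega) (by omega)
        rw [hν0] at hjk
        linarith [hν₀.2, hjk.1]
      · exact hord ν (fun j hj hjn => (hνμ j hj hjn).1) k hk hkn j hj1 hj2 hjk
    · rintro ⟨F, hF, -, -, hFf⟩
      exact hexcl F _ hF hdeg hFf hform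

/-! ### Integrability at the band edges and at infinity -/

lemma intervalIntegrable_abs_rpow : IntervalIntegrable (fun t : ℝ => |t| ^ (-(1 / 2) : ℝ)) volume
    (-1) 1 := by
  have h1 : IntervalIntegrable (fun t : ℝ => |t| ^ (-(1 / 2) : ℝ)) volume 0 1 := by
    refine (intervalIntegral.intervalIntegrable_rpow' (r := -(1 / 2)) (by norm_num)).congr
      fun t ht => ?_
    rw [uIoc_of_le zero_le_one] at ht
    simp only [abs_of_pos ht.1]
  have h2 := ((IntervalIntegrable.iff_comp_neg (by simp)).1 h1).symm
  simp only [abs_neg, neg_zero] at h2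
  exact h2.trans h1

lemma integrableAtFilter_abs_sub_rpow (a : ℝ) :
    IntegrableAtFilter (fun t : ℝ => |t - a| ^ (-(1 / 2) : ℝ)) (𝓝 a) := by
  have h := (intervalIntegrable_abs_rpow.comp_sub_right a)
  refine ⟨Ioc (-1 + a) (1 + a), Ioc_mem_nhds (by linarith) (by linarith), ?_⟩
  exact (intervalIntegrable_iff_integrableOn_Ioc_of_le (by linarith)).1 h

/-- The product of the inverse square roots of the distances to the band edges. -/
def edgeWeight (n : ℕ) (E : ℕ → ℝ) (t : ℝ) : ℝ :=
  ∏ l ∈ Finset.range (2 * n + 1), |t - E l| ^ (-(1 / 2) : ℝ)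

lemma edgeWeight_nonneg (t : ℝ) : 0 ≤ edgeWeight n E t :=
  Finset.prod_nonneg fun _ _ => by positivity

lemma measurable_edgeWeight : Measurable (edgeWeight n E) := by
  unfold edgeWeight
  fun_prop

/-- The edges are distinct, so near any point at most one factor is singular, and the exponent
`-1/2` is integrable. -/
lemma locallyIntegrable_mul_edgeWeight (hE : ∀ l : ℕ, l < 2 * n → E l < E (l + 1)) {φ : ℝ → ℝ}
    (hφ : Continuous φ) : LocallyIntegrable fun t => φ t * edgeWeight n E t := by
  classical
  intro a
  have hmeas : StronglyMeasurableAtFilter (fun t => φ t * edgeWeight n E t) (𝓝 a) :=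
    (hφ.measurable.mul measurable_edgeWeight).aestronglyMeasurable.stronglyMeasurableAtFilter
  have hc : ∀ S : Finset ℕ, (∀ l ∈ S, E l ≠ a) →
      (fun t => φ t * ∏ l ∈ S, |t - E l| ^ (-(1 / 2) : ℝ)) =O[𝓝 a] fun _ => (1 : ℝ) := by
    intro S hS
    refine Filter.Tendsto.isBigO_one ℝ ((hφ.tendsto a).mul
      (tendsto_finsetProd (a := fun l => |a - E l| ^ (-(1 / 2) : ℝ)) _ fun l hl => ?_))
    refine (ContinuousAt.rpow_const (f := fun t => |t - E l|) (by fun_prop) (Or.inl ?_)).tendsto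
    exact abs_ne_zero.2 (sub_ne_zero.2 (hS l hl).symm)
  by_cases hex : ∃ k ∈ Finset.range (2 * n + 1), E k = a
  · obtain ⟨k, hk, rfl⟩ := hex
    have h1 := (hc ((Finset.range (2 * n + 1)).erase k) fun l hl => by
      rw [Finset.mem_erase, Finset.mem_range] at hl
      rw [Finset.mem_range] at hk
      rcases lt_or_gt_of_ne hl.1 with h | h
      · exact (edge_lt hE h (by omega)).ne
      · exact (edge_lt hE h (by omega)).ne').mul
      (Asymptotics.isBigO_refl (fun t => |t - E k| ^ (-(1 / 2) : ℝ)) (𝓝 (E k)))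
    have h2 : (fun t => φ t * edgeWeight n E t) =O[𝓝 (E k)]
        fun t => |t - E k| ^ (-(1 / 2) : ℝ) := by
      refine (h1.congr (fun t => ?_) fun t => one_mul _)
      rw [edgeWeight, ← Finset.mul_prod_erase _ _ hk]
      ring
    exact h2.integrableAtFilter hmeas (integrableAtFilter_abs_sub_rpow (E k))
  · push Not at hex
    exact (hc _ hex).integrableAtFilter hmeas (locallyIntegrable_const (1 : ℝ) a)

lemma isBigO_prod_norm_sub_rpow (c : ℕ → ℂ) (N : ℕ) :
    (fun w : ℂ => ∏ l ∈ Finset.range N, ‖w - c l‖ ^ (-(1 / 2) : ℝ)) =O[Bornology.cobounded ℂ]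
      fun w : ℂ => (1 + ‖w‖) ^ (-(N / 2) : ℝ) := by
  have h1 : ∀ l ∈ Finset.range N, (fun w : ℂ => ‖w - c l‖ ^ (-(1 / 2) : ℝ))
      =O[Bornology.cobounded ℂ] fun w : ℂ => (1 + ‖w‖) ^ (-(1 / 2) : ℝ) := by
    intro l _
    have h2 := (isBigO_inv_sub (c l)).norm_left.rpow (r := 1 / 2) (by norm_num)
      (Eventually.of_forall fun w => by positivity)
    refine h2.congr (fun w => ?_) fun w => ?_
    · rw [norm_inv, Real.inv_rpow (norm_nonneg _), Real.rpow_neg (norm_nonneg _)]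
    · rw [← Real.rpow_mul (by positivity)]; norm_num
  refine (Asymptotics.IsBigO.finsetProd h1).congr_right fun w => ?_
  rw [Finset.prod_const, Finset.card_range, ← Real.rpow_mul_natCast (by positivity)]
  congr 1
  ring

/-- At infinity the weight behaves like `|t|^(-n - 1/2)`, so the power `n - 1` leaves `|t|^(-3/2)`.
This majorant serves every product of a polynomial of degree `m` with a kernel of decay `n - 1 - m`.
-/
lemma integrable_rpow_mul_edgeWeight (hE : ∀ l : ℕ, l < 2 * n → E l < E (l + 1)) :
    Integrable fun t : ℝ => (1 + ‖t‖) ^ ((n : ℝ) - 1) * edgeWeight n E t := by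
  refine (locallyIntegrable_mul_edgeWeight hE ?_).integrable_of_isBigO_cocompact (μ := volume)
    (g := fun t : ℝ => (1 + ‖t‖) ^ (-(3 / 2) : ℝ)) ?_
    ((integrable_one_add_norm (by norm_num)).integrableAtFilter _)
  · exact (by fun_prop : Continuous fun t : ℝ => 1 + ‖t‖).rpow_const fun t =>
      Or.inl (by positivity)
  · have h1 := (isBigO_prod_norm_sub_rpow (fun l => (E l : ℂ)) (2 * n + 1)).comp_tendsto
      (tendsto_ofReal_upperInfty.mono_right inf_le_left)
    have h2 := (Asymptotics.isBigO_refl (fun t : ℝ => (1 + ‖t‖) ^ ((n : ℝ) - 1))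
      (cocompact ℝ)).mul h1
    refine h2.congr (fun t => ?_) fun t => ?_
    · simp only [Function.comp_apply, edgeWeight, ← Complex.ofReal_sub, Complex.norm_real,
        Real.norm_eq_abs]
    · simp only [Function.comp_apply, Complex.norm_real]
      rw [one_add_norm_rpow_mul]
      congr 1
      push_cast
      ring

lemma norm_sqrtProd_inv (z : ℂ) : ‖(sqrtProd n E z)⁻¹‖ =
    ∏ l ∈ Finset.range (2 * n + 1), ‖z - E l‖ ^ (-(1 / 2) : ℝ) := by
  rw [norm_inv, sqrtProd, norm_prod, ← Finset.prod_inv_distrib]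
  refine Finset.prod_congr rfl fun l _ => ?_
  rw [Real.rpow_neg (norm_nonneg _), show (1 / 2 : ℂ) = ((1 / 2 : ℝ) : ℂ) by push_cast; rfl,
    Complex.norm_cpow_real]

/-- Moving vertically off the line only increases the distance to each edge, so one weight dominates
all heights. -/
lemma norm_sqrtProd_inv_le {t : ℝ} (ht : ∀ l, t ≠ E l) (δ : ℝ) :
    ‖(sqrtProd n E (t + δ * Complex.I))⁻¹‖ ≤ edgeWeight n E t := by
  rw [norm_sqrtProd_inv]
  refine Finset.prod_le_prod (fun l _ => by positivity) fun l _ => ?_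
  refine Real.rpow_le_rpow_of_nonpos (abs_pos.2 (sub_ne_zero.2 (ht l))) ?_ (by norm_num)
  simpa using Complex.abs_re_le_norm ((t : ℂ) + δ * Complex.I - E l)

lemma exists_norm_eval_le (F : Polynomial ℂ) {m : ℕ} (hF : F.natDegree ≤ m) :
    ∃ C : ℝ, 0 ≤ C ∧ ∀ (w : ℂ) (δ : ℝ), 0 ≤ δ → δ ≤ 1 →
      ‖F.eval (w + δ * Complex.I)‖ ≤ C * (1 + ‖w‖) ^ (m : ℝ) := by
  refine ⟨∑ i ∈ Finset.range (m + 1), ‖F.coeff i‖ * 2 ^ i, by positivity, fun w δ h0 h1 => ?_⟩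
  rw [Polynomial.eval_eq_sum_range' (Nat.lt_succ_of_le hF), Finset.sum_mul, Real.rpow_natCast]
  refine (norm_sum_le _ _).trans (Finset.sum_le_sum fun i hi => ?_)
  have hw : ‖w + δ * Complex.I‖ ≤ 2 * (1 + ‖w‖) := by
    refine (norm_add_le _ _).trans ?_
    rw [norm_mul, Complex.norm_I, Complex.norm_real, Real.norm_of_nonneg h0]
    linarith [norm_nonneg w]
  rw [norm_mul, norm_pow, mul_assoc]
  gcongr
  calc ‖w + δ * Complex.I‖ ^ i ≤ (2 * (1 + ‖w‖)) ^ i := by gcongr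
    _ = 2 ^ i * (1 + ‖w‖) ^ i := mul_pow _ _ _
    _ ≤ 2 ^ i * (1 + ‖w‖) ^ m := by
      gcongr
      · linarith [norm_nonneg w]
      · rw [Finset.mem_range] at hi; omega

/-! ### The quotient `i F / R^{1/2}` and admissible kernels -/

/-- The function `i F(z) / R(z)^{1/2}` in the closed upper half-plane. -/
def quotient (n : ℕ) (E : ℕ → ℝ) (F : Polynomial ℂ) (z : ℂ) : ℂ :=
  Complex.I * F.eval z / sqrtProd n E z

lemma differentiableOn_quotient (F : Polynomial ℂ) :
    DifferentiableOn ℂ (quotient n E F) {w : ℂ | 0 < w.im} :=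
  (F.differentiable.differentiableOn.const_mul _).div differentiableOn_sqrtProd
    fun _ hw => sqrtProd_ne_zero_of_im_pos hw

lemma differentiableOn_quotient_shift (F : Polynomial ℂ) (δ : ℝ) :
    DifferentiableOn ℂ (fun w => quotient n E F (w + δ * Complex.I)) {w : ℂ | -δ < w.im} := by
  refine (differentiableOn_quotient F).comp (by fun_prop) fun w hw => ?_
  rw [mem_ofPred_eq] at hw ⊢
  rw [im_add_mul_I]
  linarith

lemma isBigO_quotient_shift (F : Polynomial ℂ) {m : ℕ} (hF : F.natDegree ≤ m) {δ : ℝ}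
    (h0 : 0 ≤ δ) (h1 : δ ≤ 1) : (fun w => quotient n E F (w + δ * Complex.I)) =O[upperInfty]
      fun w : ℂ => (1 + ‖w‖) ^ ((m : ℝ) - n - 1 / 2) := by
  obtain ⟨C, -, hC⟩ := exists_norm_eval_le F hF
  have hFO : (fun w : ℂ => F.eval (w + δ * Complex.I)) =O[Bornology.cobounded ℂ]
      fun w : ℂ => (1 + ‖w‖) ^ (m : ℝ) :=
    Asymptotics.IsBigO.of_bound C (Eventually.of_forall fun w => by
      rw [Real.norm_of_nonneg (by positivity)]
      exact hC w δ h0 h1)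
  have hS : (fun w : ℂ => (sqrtProd n E (w + δ * Complex.I))⁻¹) =O[Bornology.cobounded ℂ]
      fun w : ℂ => (1 + ‖w‖) ^ (-((2 * n + 1 : ℕ) / 2) : ℝ) := by
    refine Asymptotics.IsBigO.of_norm_left ?_
    simp_rw [norm_sqrtProd_inv]
    refine (isBigO_prod_norm_sub_rpow (fun l => E l - δ * Complex.I) (2 * n + 1)).congr_left
      fun w => Finset.prod_congr rfl fun l _ => ?_
    congr 2
    ring
  refine (((hFO.const_mul_left Complex.I).mul hS).mono inf_le_left).congr (fun w => ?_) fun w => ?_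
  · rw [quotient, div_eq_mul_inv]
  · rw [one_add_norm_rpow_mul]
    congr 1
    push_cast
    ring

lemma ae_forall_ne (E : ℕ → ℝ) : ∀ᵐ t : ℝ, ∀ l, t ≠ E l :=
  ae_all_iff.2 fun l => Measure.ae_ne volume (E l)

lemma exists_norm_quotient_le (F : Polynomial ℂ) {m : ℕ} (hF : F.natDegree ≤ m) :
    ∃ C : ℝ, 0 ≤ C ∧ ∀ t : ℝ, (∀ l, t ≠ E l) → ∀ δ : ℝ, 0 ≤ δ → δ ≤ 1 →
      ‖quotient n E F (t + δ * Complex.I)‖ ≤ C * ((1 + ‖t‖) ^ (m : ℝ) * edgeWeight n E t) := by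
  obtain ⟨C, hC0, hC⟩ := exists_norm_eval_le F hF
  refine ⟨C, hC0, fun t ht δ h0 h1 => ?_⟩
  rw [quotient, div_eq_mul_inv, norm_mul, norm_mul, Complex.norm_I, one_mul, ← mul_assoc]
  have := hC t δ h0 h1
  rw [Complex.norm_real] at this
  exact mul_le_mul this (norm_sqrtProd_inv_le ht δ) (norm_nonneg _) (by positivity)

lemma tendsto_quotient (F : Polynomial ℂ) {t : ℝ} (ht : ∀ l ≤ 2 * n, t ≠ E l) :
    Tendsto (fun ε : ℝ => quotient n E F (t + ε * Complex.I)) (𝓝[>] 0)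
      (𝓝 (quotient n E F t)) := by
  have hne : ∀ l ≤ 2 * n, (t : ℂ) ≠ E l := fun l hl h => ht l hl (Complex.ofReal_injective h)
  have hF : ContinuousWithinAt (fun w : ℂ => Complex.I * F.eval w) {w : ℂ | 0 ≤ w.im} (t : ℂ) :=
    (continuous_const.mul F.continuous).continuousWithinAt
  exact (hF.div (continuousWithinAt_sqrtProd hne)
    (sqrtProd_ne_zero hne)).tendsto.comp (tendsto_vertical t)

lemma measurable_quotient (F : Polynomial ℂ) : Measurable fun t : ℝ => quotient n E F t := by
  unfold quotient sqrtProd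
  refine Measurable.div (measurable_const.mul
    (F.continuous.measurable.comp Complex.measurable_ofReal)) (Finset.measurable_fun_prod _
      fun l _ => ?_)
  exact (Complex.measurable_ofReal.sub_const _).pow_const _

/-- Kernels that decay fast enough to be integrated against `F / R^{1/2}` for `F` of degree at
most `m`. -/
def IsDecaying (n m : ℕ) (κ : ℝ → ℂ) : Prop :=
  Measurable κ ∧ ∃ C : ℝ, 0 ≤ C ∧ ∀ t : ℝ, ‖κ t‖ ≤ C * (1 + ‖t‖) ^ ((n : ℝ) - 1 - m)

lemma exists_norm_quotient_mul_le (F : Polynomial ℂ) {m : ℕ} (hF : F.natDegree ≤ m) {κ : ℝ → ℂ}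
    (hκ : IsDecaying n m κ) : ∃ C : ℝ, ∀ t : ℝ, (∀ l, t ≠ E l) → ∀ δ : ℝ, 0 ≤ δ → δ ≤ 1 →
      ‖quotient n E F (t + δ * Complex.I) * κ t‖ ≤
        C * ((1 + ‖t‖) ^ ((n : ℝ) - 1) * edgeWeight n E t) := by
  obtain ⟨C, hC0, hC⟩ := exists_norm_quotient_le (n := n) (E := E) F hF
  obtain ⟨-, D, hD0, hD⟩ := hκ
  refine ⟨C * D, fun t ht δ h0 h1 => ?_⟩
  rw [norm_mul]
  refine (mul_le_mul (hC t ht δ h0 h1) (hD t) (norm_nonneg _)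
    (mul_nonneg hC0 (mul_nonneg (by positivity) (edgeWeight_nonneg t)))).trans (le_of_eq ?_)
  rw [show ((n : ℝ) - 1) = m + (n - 1 - m) by ring, Real.rpow_add (by positivity)]
  rw [show ((m : ℝ) + (n - 1 - m) - m) = n - 1 - m by ring]
  ring

lemma integrable_quotient_mul (hE : ∀ l : ℕ, l < 2 * n → E l < E (l + 1)) (F : Polynomial ℂ)
    {m : ℕ} (hF : F.natDegree ≤ m) {κ : ℝ → ℂ} (hκ : IsDecaying n m κ) :
    Integrable fun t : ℝ => quotient n E F t * κ t := by
  obtain ⟨C, hC⟩ := exists_norm_quotient_mul_le (E := E) F hF hκ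
  refine ((integrable_rpow_mul_edgeWeight hE).const_mul C).mono'
    ((measurable_quotient F).mul hκ.1).aestronglyMeasurable ?_
  filter_upwards [ae_forall_ne E] with t ht
  simpa using hC t ht 0 le_rfl zero_le_one

lemma tendsto_integral_quotient_mul (hE : ∀ l : ℕ, l < 2 * n → E l < E (l + 1))
    (F : Polynomial ℂ) {m : ℕ} (hF : F.natDegree ≤ m) {κ : ℝ → ℂ} (hκ : IsDecaying n m κ) :
    Tendsto (fun k => ∫ t : ℝ, quotient n E F (t + heightSeq k * Complex.I) * κ t) atTop
      (𝓝 (∫ t : ℝ, quotient n E F t * κ t)) := by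
  obtain ⟨C, hC⟩ := exists_norm_quotient_mul_le (E := E) F hF hκ
  refine tendsto_integral_of_dominated_convergence _ (fun k => ?_)
    ((integrable_rpow_mul_edgeWeight hE).const_mul C) (fun k => ?_) ?_
  · exact ((continuous_shift (differentiableOn_quotient F)
      (heightSeq_pos k)).measurable.mul hκ.1).aestronglyMeasurable
  · filter_upwards [ae_forall_ne E] with t ht
    exact hC t ht _ (heightSeq_pos k).le (heightSeq_le_one k)
  · filter_upwards [ae_forall_ne E] with t ht
    exact ((tendsto_quotient F fun l _ => ht l).comp tendsto_heightSeq).mul_const _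

lemma exists_norm_inv_sub_le {S : Set ℝ} {p : ℂ} {d : ℝ} (hd : 0 < d)
    (hS : ∀ t ∈ S, d ≤ ‖(t : ℂ) - p‖) :
    ∃ C : ℝ, 0 ≤ C ∧ ∀ t ∈ S, ‖((t : ℂ) - p)⁻¹‖ ≤ C * (1 + ‖t‖) ^ (-1 : ℝ) := by
  -- The constant comes from `1 + |t| ≤ (1 + |p|) + |t - p|` and `1 ≤ |t - p| / d`.
  refine ⟨(1 + ‖p‖) / d + 1, by positivity, fun t ht => ?_⟩
  have h1 := hS t ht
  have h2 : 0 < ‖(t : ℂ) - p‖ := hd.trans_le h1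
  have h3 : ‖t‖ ≤ ‖p‖ + ‖(t : ℂ) - p‖ := by
    rw [← Complex.norm_real]
    simpa using norm_add_le p ((t : ℂ) - p)
  rw [norm_inv, Real.rpow_neg_one, ← div_eq_mul_inv, inv_eq_one_div,
    div_le_div_iff₀ h2 (by positivity)]
  have h4 : 1 + ‖p‖ ≤ (1 + ‖p‖) / d * ‖(t : ℂ) - p‖ := by
    rw [div_mul_eq_mul_div, le_div_iff₀ hd]
    gcongr
  linarith

lemma IsDecaying.add {m : ℕ} {κ κ' : ℝ → ℂ} (h : IsDecaying n m κ) (h' : IsDecaying n m κ') :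
    IsDecaying n m fun t => κ t + κ' t := by
  obtain ⟨hm, C, hC0, hC⟩ := h
  obtain ⟨hm', C', hC0', hC'⟩ := h'
  refine ⟨hm.add hm', C + C', by positivity, fun t => (norm_add_le _ _).trans ?_⟩
  rw [add_mul]
  exact add_le_add (hC t) (hC' t)

lemma IsDecaying.const_mul {m : ℕ} {κ : ℝ → ℂ} (h : IsDecaying n m κ) (c : ℂ) :
    IsDecaying n m fun t => c * κ t := by
  obtain ⟨hm, C, hC0, hC⟩ := h
  refine ⟨hm.const_mul c, ‖c‖ * C, by positivity, fun t => ?_⟩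
  rw [norm_mul, mul_assoc]
  gcongr
  exact hC t

lemma IsDecaying.conj {m : ℕ} {κ : ℝ → ℂ} (h : IsDecaying n m κ) :
    IsDecaying n m fun t => conj (κ t) := by
  obtain ⟨hm, C, hC0, hC⟩ := h
  exact ⟨Complex.continuous_conj.measurable.comp hm, C, hC0, fun t => by
    rw [Complex.norm_conj]; exact hC t⟩

lemma measurable_inv_sub (p : ℂ) : Measurable fun t : ℝ => ((t : ℂ) - p)⁻¹ :=
  (Complex.measurable_ofReal.sub_const p).inv

/-- The indicator is there for real `p` in a gap, where the kernel is singular although it is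
bounded on the bands. -/
lemma isDecaying_indicator_inv_sub {m : ℕ} (hm : m ≤ n) {S : Set ℝ} (hSm : MeasurableSet S)
    {p : ℂ} {d : ℝ} (hd : 0 < d) (hS : ∀ t ∈ S, d ≤ ‖(t : ℂ) - p‖) :
    IsDecaying n m (S.indicator fun t : ℝ => ((t : ℂ) - p)⁻¹) := by
  obtain ⟨C, hC0, hC⟩ := exists_norm_inv_sub_le hd hS
  refine ⟨(measurable_inv_sub p).indicator hSm, C, hC0, fun t => ?_⟩
  have hm' : (m : ℝ) ≤ n := by exact_mod_cast hm
  by_cases ht : t ∈ S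
  · rw [indicator_of_mem ht]
    refine (hC t ht).trans ?_
    gcongr ?_ * ?_
    exact Real.rpow_le_rpow_of_exponent_le (by linarith [norm_nonneg t]) (by linarith)
  · rw [indicator_of_notMem ht, norm_zero]
    positivity

lemma isDecaying_indicator_inv_sub_mul {m : ℕ} (hm : m ≤ n + 1) {S : Set ℝ}
    (hSm : MeasurableSet S) {p q : ℂ} {d : ℝ} (hd : 0 < d) (hp : ∀ t ∈ S, d ≤ ‖(t : ℂ) - p‖)
    {d' : ℝ} (hd' : 0 < d') (hq : ∀ t ∈ S, d' ≤ ‖(t : ℂ) - q‖) :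
    IsDecaying n m (S.indicator fun t : ℝ => ((t : ℂ) - p)⁻¹ * ((t : ℂ) - q)⁻¹) := by
  obtain ⟨C, hC0, hC⟩ := exists_norm_inv_sub_le hd hp
  obtain ⟨D, hD0, hD⟩ := exists_norm_inv_sub_le hd' hq
  refine ⟨((measurable_inv_sub p).mul (measurable_inv_sub q)).indicator hSm, C * D,
    by positivity, fun t => ?_⟩
  have hm' : (m : ℝ) ≤ n + 1 := by exact_mod_cast hm
  by_cases ht : t ∈ S
  · rw [indicator_of_mem ht, norm_mul]
    refine (mul_le_mul (hC t ht) (hD t ht) (norm_nonneg _) (by positivity)).trans ?_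
    rw [mul_mul_mul_comm, one_add_norm_rpow_mul]
    gcongr ?_ * ?_
    exact Real.rpow_le_rpow_of_exponent_le (by linarith [norm_nonneg t]) (by linarith)
  · rw [indicator_of_notMem ht, norm_zero]
    positivity

lemma le_norm_ofReal_sub (p : ℂ) (t : ℝ) : |p.im| ≤ ‖(t : ℂ) - p‖ := by
  simpa using Complex.abs_im_le_norm ((t : ℂ) - p)

lemma isDecaying_inv_sub {m : ℕ} (hm : m ≤ n) {p : ℂ} (hp : p.im ≠ 0) :
    IsDecaying n m fun t : ℝ => ((t : ℂ) - p)⁻¹ := by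
  simpa using isDecaying_indicator_inv_sub hm MeasurableSet.univ (abs_pos.2 hp)
    fun t _ => le_norm_ofReal_sub p t

/-- The difference of two Cauchy kernels decays like `t^(-2)`, one order better than a single one;
this admits degree `n + 1`. -/
lemma isDecaying_inv_sub_sub {m : ℕ} (hm : m ≤ n + 1) {p q : ℂ} (hp : p.im ≠ 0)
    (hq : q.im ≠ 0) : IsDecaying n m fun t : ℝ => ((t : ℂ) - p)⁻¹ - ((t : ℂ) - q)⁻¹ := by
  have h := (isDecaying_indicator_inv_sub_mul hm MeasurableSet.univ (abs_pos.2 hp)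
    (fun t _ => le_norm_ofReal_sub p t) (abs_pos.2 hq)
    fun t _ => le_norm_ofReal_sub q t).const_mul (p - q)
  simp only [indicator_univ] at h
  convert h using 2 with t
  exact inv_sub_inv_eq_mul (ofReal_ne_of_im_ne_zero hp t) (ofReal_ne_of_im_ne_zero hq t)

/-! ### Cauchy integrals of the quotient over the real line -/

lemma isBigO_quotient_shift_half (F : Polynomial ℂ) {m : ℕ} (hF : F.natDegree ≤ m)
    (hm : m ≤ n + 1) (k : ℕ) :
    (fun w => quotient n E F (w + heightSeq k * Complex.I)) =O[upperInfty]
      fun w : ℂ => (1 + ‖w‖) ^ (1 / 2 : ℝ) := by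
  have hm' : (m : ℝ) ≤ n + 1 := by exact_mod_cast hm
  exact (isBigO_quotient_shift F hF (heightSeq_pos k).le (heightSeq_le_one k)).trans
    (isBigO_one_add_norm_rpow_mono (by linarith) _)

lemma integral_quotient_mul_lower (hE : ∀ l : ℕ, l < 2 * n → E l < E (l + 1)) (F : Polynomial ℂ)
    {m : ℕ} (hF : F.natDegree ≤ m) (hm : m ≤ n + 1) {p q : ℂ} (hp : p.im < 0) (hq : q.im < 0) :
    ∫ t : ℝ, quotient n E F t * (((t : ℂ) - p)⁻¹ - ((t : ℂ) - q)⁻¹) = 0 := by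
  refine tendsto_nhds_unique (tendsto_integral_quotient_mul hE F hF
    (isDecaying_inv_sub_sub hm hp.ne hq.ne)) (tendsto_const_nhds.congr fun k => ?_)
  exact (integral_mul_inv_sub_sub_inv_sub_eq_zero (heightSeq_pos k)
    (differentiableOn_quotient_shift F _) (isBigO_quotient_shift_half F hF hm k) hp hq).symm

lemma integral_quotient_mul_upper (hE : ∀ l : ℕ, l < 2 * n → E l < E (l + 1)) (F : Polynomial ℂ)
    {m : ℕ} (hF : F.natDegree ≤ m) (hm : m ≤ n + 1) {p q : ℂ} (hp : 0 < p.im) (hq : q.im < 0) :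
    ∫ t : ℝ, quotient n E F t * (((t : ℂ) - p)⁻¹ - ((t : ℂ) - q)⁻¹) =
      2 * Real.pi * Complex.I * quotient n E F p := by
  have hp' : (conj p).im < 0 := by simpa using hp
  have h1 : ∫ t : ℝ, quotient n E F t * (((t : ℂ) - p)⁻¹ - ((t : ℂ) - conj p)⁻¹) =
      2 * Real.pi * Complex.I * quotient n E F p := by
    refine tendsto_nhds_unique (tendsto_integral_quotient_mul hE F hF
      (isDecaying_inv_sub_sub hm hp.ne' hp'.ne))
      (((tendsto_add_heightSeq (differentiableOn_quotient F) hp).const_mul _).congr fun k => ?_)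
    exact (integral_mul_inv_sub_sub_inv_sub_conj (heightSeq_pos k)
      (differentiableOn_quotient_shift F _) (isBigO_quotient_shift_half F hF hm k) hp).2.symm
  -- Moving the lower pole from `conj p` to `q` costs nothing, since the corresponding kernel has
  -- both poles below the line.
  have h2 := integral_quotient_mul_lower hE F hF hm hp' hq
  rw [← h1, ← add_zero (∫ t : ℝ, quotient n E F t * (((t : ℂ) - p)⁻¹ - ((t : ℂ) - conj p)⁻¹)),
    ← h2, ← integral_add
      (integrable_quotient_mul hE F hF (isDecaying_inv_sub_sub hm hp.ne' hp'.ne))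
      (integrable_quotient_mul hE F hF (isDecaying_inv_sub_sub hm hp'.ne hq.ne))]
  congr 1 with t
  ring

/-- In degree `n` the quotient decays like `|w|^(-1/2)`, so a single Cauchy kernel already gives the
decay `|w|^(-3/2)` needed for closing the contour. -/
lemma integral_quotient_mul_inv_sub_lower (hE : ∀ l : ℕ, l < 2 * n → E l < E (l + 1))
    (F : Polynomial ℂ) (hF : F.natDegree ≤ n) {q : ℂ} (hq : q.im < 0) :
    ∫ t : ℝ, quotient n E F t * ((t : ℂ) - q)⁻¹ = 0 := by
  refine tendsto_nhds_unique (tendsto_integral_quotient_mul hE F hF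
    (isDecaying_inv_sub le_rfl hq.ne)) (tendsto_const_nhds.congr fun k => ?_)
  set η := min (heightSeq k) (-q.im) with hη
  have hη0 : 0 < η := by simp [hη, heightSeq_pos, hq]
  have hηk : η ≤ heightSeq k := min_le_left _ _
  have hηq : η ≤ -q.im := min_le_right _ _
  have hd := ((differentiableOn_quotient_shift (n := n) (E := E) F (heightSeq k)).mono
    (halfPlane_mono hηk)).mul
    (differentiableOn_inv_sub (p := q) (s := {w : ℂ | -η < w.im}) (by simp; linarith))
  refine (integral_ofReal_eq_zero hη0 hd ?_).symm
  have hO := (isBigO_quotient_shift (n := n) (E := E) F hF (heightSeq_pos k).le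
    (heightSeq_le_one k)).mul ((isBigO_inv_sub q).mono inf_le_left)
  refine hO.congr (fun w => rfl) fun w => ?_
  rw [one_add_norm_rpow_mul]
  norm_num

lemma integral_quotient_mul_inv_sub_upper (hE : ∀ l : ℕ, l < 2 * n → E l < E (l + 1))
    (F : Polynomial ℂ) (hF : F.natDegree ≤ n) {p : ℂ} (hp : 0 < p.im) :
    ∫ t : ℝ, quotient n E F t * ((t : ℂ) - p)⁻¹ = 2 * Real.pi * Complex.I * quotient n E F p := by
  have hp' : (conj p).im < 0 := by simpa using hp
  have h1 := integral_quotient_mul_upper hE F hF (Nat.le_succ n) hp hp'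
  simp_rw [mul_sub] at h1
  rwa [integral_sub (integrable_quotient_mul hE F hF (isDecaying_inv_sub le_rfl hp.ne'))
    (integrable_quotient_mul hE F hF (isDecaying_inv_sub le_rfl hp'.ne)),
    integral_quotient_mul_inv_sub_lower hE F hF hp', sub_zero] at h1

/-! ### Real and imaginary values of the square root on the line -/

lemma sqrtProd_sq (t : ℝ) : sqrtProd n E t ^ 2 =
    (((t - E 0) * ∏ j ∈ Finset.Icc 1 n, ((t - E (2 * j - 1)) * (t - E (2 * j))) : ℝ) : ℂ) := by
  have h1 : sqrtProd n E t ^ 2 = ((∏ l ∈ Finset.range (2 * n + 1), (t - E l) : ℝ) : ℂ) := by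
    rw [sqrtProd, ← Finset.prod_pow]
    push_cast
    refine Finset.prod_congr rfl fun l _ => ?_
    rw [← Complex.cpow_nat_mul]
    norm_num
  rw [h1]
  congr 1
  clear h1
  induction n with
  | zero => simp
  | succ k ih =>
    rw [Finset.prod_Icc_succ_top (by omega), show 2 * (k + 1) + 1 = 2 * k + 1 + 1 + 1 by ring,
      Finset.prod_range_succ, Finset.prod_range_succ, ih,
      show 2 * (k + 1) - 1 = 2 * k + 1 by omega, show 2 * (k + 1) = 2 * k + 1 + 1 by ring]
    ring

lemma mul_sub_nonneg_of_notMem_Ioo {a b t : ℝ} (h : t ∉ Ioo a b) (hab : a ≤ b) :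
    0 ≤ (t - a) * (t - b) := by
  rcases le_or_gt t a with h1 | h1
  · exact mul_nonneg_of_nonpos_of_nonpos (by linarith) (by linarith)
  · have h2 : b ≤ t := by
      by_contra h3
      exact h ⟨h1, not_le.1 h3⟩
    exact mul_nonneg (by linarith) (by linarith)

lemma im_eq_zero_of_sq_eq {w : ℂ} {r : ℝ} (h : w ^ 2 = (r : ℂ)) (hr : 0 ≤ r) : w.im = 0 := by
  have h1 := congrArg Complex.re h
  have h2 := congrArg Complex.im h
  simp only [pow_two, Complex.mul_re, Complex.mul_im, Complex.ofReal_re, Complex.ofReal_im] at h1 h2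
  by_contra h3
  have h4 : w.re = 0 := by
    have : w.re * w.im = 0 := by linarith
    exact (mul_eq_zero.1 this).resolve_right h3
  rw [h4] at h1
  have := mul_self_pos.2 h3
  linarith

lemma re_eq_zero_of_sq_eq {w : ℂ} {r : ℝ} (h : w ^ 2 = (r : ℂ)) (hr : r ≤ 0) : w.re = 0 := by
  have h1 : (w * Complex.I) ^ 2 = ((-r : ℝ) : ℂ) := by
    rw [mul_pow, Complex.I_sq, h]; push_cast; ring
  simpa using im_eq_zero_of_sq_eq h1 (by linarith)

lemma sqrtProd_im_eq_zero (hE : ∀ l : ℕ, l < 2 * n → E l < E (l + 1)) {t : ℝ}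
    (ht : t ∈ bandSet n E) : (sqrtProd n E t).im = 0 := by
  refine im_eq_zero_of_sq_eq (sqrtProd_sq t) (mul_nonneg ?_ (Finset.prod_nonneg fun j hj => ?_))
  · linarith [le_of_mem_bandSet hE ht]
  · obtain ⟨hj1, hj2⟩ := Finset.mem_Icc.1 hj
    exact mul_sub_nonneg_of_notMem_Ioo (notMem_gap_of_mem_bandSet hE ht hj1 hj2)
      (edge_le hE (by omega) (by omega))

lemma sqrtProd_re_eq_zero (hE : ∀ l : ℕ, l < 2 * n → E l < E (l + 1)) {t : ℝ}
    (ht : t ∉ bandSet n E) : (sqrtProd n E t).re = 0 := by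
  refine re_eq_zero_of_sq_eq (sqrtProd_sq t) ?_
  rcases exists_gap_of_notMem_bandSet ht with hlt | ⟨k, hk, hkn, hk1, hk2⟩
  · refine mul_nonpos_of_nonpos_of_nonneg (by linarith) (Finset.prod_nonneg fun j hj => ?_)
    obtain ⟨hj1, hj2⟩ := Finset.mem_Icc.1 hj
    refine mul_sub_nonneg_of_notMem_Ioo (fun h => ?_) (edge_le hE (by omega) (by omega))
    have := edge_le hE (Nat.zero_le (2 * j - 1)) (by omega)
    linarith [h.1]
  · have hE0 := edge_le hE (Nat.zero_le (2 * k - 1)) (by omega)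
    -- Inside gap `k` exactly that gap's pair of factors has a negative product; every other pair is
    -- nonnegative.
    rw [← Finset.mul_prod_erase _ _ (Finset.mem_Icc.2 ⟨hk, hkn⟩)]
    refine mul_nonpos_of_nonneg_of_nonpos (by linarith) (mul_nonpos_of_nonpos_of_nonneg
      (mul_nonpos_of_nonneg_of_nonpos (by linarith) (by linarith))
      (Finset.prod_nonneg fun j hj => ?_))
    rw [Finset.mem_erase, Finset.mem_Icc] at hj
    obtain ⟨hjk, hj1, hj2⟩ := hj
    refine mul_sub_nonneg_of_notMem_Ioo (fun h => ?_) (edge_le hE (by omega) (by omega))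
    rcases lt_or_gt_of_ne hjk with hl | hl
    · have := edge_le hE (show 2 * j ≤ 2 * k - 1 by omega) (by omega)
      linarith [h.2]
    · have := edge_le hE (show 2 * k ≤ 2 * j - 1 by omega) (by omega)
      linarith [h.1]

lemma quotient_eq_mul_sqrtR (F : Polynomial ℂ) {z : ℂ} (hz : 0 ≤ z.im) :
    quotient n E F z = Complex.I * F.eval z / sqrtR n E z := by
  rw [quotient, sqrtR_of_im_nonneg hz]

/-- The symmetry of a Herglotz function `i F / R^{1/2}` forces `F` to be real on the real line. -/
lemma eval_conj_of_isHerglotz {F : Polynomial ℂ}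
    (hM : IsHerglotz fun z => Complex.I * F.eval z / sqrtR n E z) {z : ℂ} (hz : 0 < z.im) :
    F.eval (conj z) = conj (F.eval z) := by
  have h := hM.symm z hz
  simp only [sqrtR_conj hz, sqrtR_of_im_nonneg hz.le, map_div₀, map_mul, Complex.conj_I] at h
  have hne : conj (sqrtProd n E z) ≠ 0 := by
    simpa using sqrtProd_ne_zero_of_im_pos (n := n) (E := E) hz
  rw [div_neg, neg_mul, neg_div, neg_inj, div_left_inj' hne] at h
  exact mul_left_cancel₀ Complex.I_ne_zero h

lemma eval_ofReal_im_of_isHerglotz {F : Polynomial ℂ}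
    (hM : IsHerglotz fun z => Complex.I * F.eval z / sqrtR n E z) (t : ℝ) :
    (F.eval (t : ℂ)).im = 0 := by
  have h1 := (tendsto_vertical t).mono_right nhdsWithin_le_nhds
  have h2 := (Complex.continuous_conj.tendsto _).comp ((F.continuous.tendsto _).comp h1)
  have h3 := (F.continuous.tendsto _).comp ((Complex.continuous_conj.tendsto _).comp h1)
  rw [Complex.conj_ofReal] at h3
  have h4 := tendsto_nhds_unique (h3.congr' (eventually_mem_nhdsWithin.mono fun ε hε =>
    eval_conj_of_isHerglotz hM (by simpa using hε))) h2
  have h5 := congrArg Complex.im h4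
  rw [Complex.conj_im] at h5
  linarith

lemma div_sqrtR_im_eq_zero (hE : ∀ l : ℕ, l < 2 * n → E l < E (l + 1)) {F : Polynomial ℂ} {t : ℝ}
    (hF : (F.eval (t : ℂ)).im = 0) (ht : t ∈ bandSet n E) :
    (F.eval (t : ℂ) / sqrtR n E t).im = 0 := by
  rw [sqrtR_of_im_nonneg (by simp), Complex.div_im, hF, sqrtProd_im_eq_zero hE ht]
  simp

lemma quotient_im_eq_zero (hE : ∀ l : ℕ, l < 2 * n → E l < E (l + 1)) {F : Polynomial ℂ} {t : ℝ}
    (hF : (F.eval (t : ℂ)).im = 0) (ht : t ∉ bandSet n E) : (quotient n E F t).im = 0 := by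
  rw [quotient, mul_div_assoc, Complex.I_mul_im, Complex.div_re, hF, sqrtProd_re_eq_zero hE ht]
  simp

lemma isClosed_bandSet : IsClosed (bandSet n E) :=
  ((finite_Iio n).isClosed_biUnion fun _ _ => isClosed_Icc).union isClosed_Ici

lemma measurableSet_bandSet : MeasurableSet (bandSet n E) := isClosed_bandSet.measurableSet

lemma exists_le_norm_sub_of_mem_offBands {z : ℂ} (hz : z ∈ offBands n E) :
    ∃ d : ℝ, 0 < d ∧ ∀ t ∈ bandSet n E, d ≤ ‖(t : ℂ) - z‖ := by
  have hopen : IsOpen (offBands n E) :=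
    (Complex.isometry_ofReal.isClosedEmbedding.isClosedMap _ isClosed_bandSet).isOpen_compl
  obtain ⟨d, hd, hball⟩ := Metric.isOpen_iff.1 hopen z hz
  refine ⟨d, hd, fun t ht => ?_⟩
  by_contra hlt
  have hmem : (t : ℂ) ∈ Metric.ball z d := by
    rw [Metric.mem_ball, dist_eq_norm]
    exact not_le.1 hlt
  exact hball hmem ⟨t, ht, rfl⟩

lemma mem_offBands_of_im_ne_zero {z : ℂ} (hz : z.im ≠ 0) : z ∈ offBands n E := by
  rintro ⟨x, -, rfl⟩
  simp at hz

/-! ### The integral representations -/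

/-- Integration over the bands in terms of the boundary values on the whole line. -/
lemma setIntegral_bandSet_eq (hE : ∀ l : ℕ, l < 2 * n → E l < E (l + 1)) {F : Polynomial ℂ}
    {m : ℕ} (hF : F.natDegree ≤ m) (hreal : ∀ t : ℝ, (F.eval (t : ℂ)).im = 0) {κ : ℝ → ℂ}
    (hκ : IsDecaying n m κ) :
    2 * Complex.I * ∫ t in bandSet n E, F.eval (t : ℂ) / sqrtR n E t * κ t =
      (∫ t : ℝ, quotient n E F t * κ t) - conj (∫ t : ℝ, quotient n E F t * conj (κ t)) := by
  have hi := integrable_quotient_mul hE F hF hκ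
  have hi' := Complex.conjCLE.toContinuousLinearMap.integrable_comp
    (integrable_quotient_mul hE F hF hκ.conj)
  rw [← integral_conj, ← integral_sub hi (by simpa using hi'), ← integral_const_mul,
    ← integral_indicator measurableSet_bandSet]
  refine integral_congr_ae (Eventually.of_forall fun t => ?_)
  -- The integrand becomes `(q - conj q) κ`. On the bands `q` is `i` times the real number `F /
  -- R^{1/2}`, which gives `2 i F / R^{1/2}`; elsewhere `q` is real and the difference vanishes.
  simp only [map_mul, Complex.conj_conj, ← sub_mul]
  by_cases ht : t ∈ bandSet n E
  · rw [indicator_of_mem ht]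
    have h1 : conj (F.eval (t : ℂ) / sqrtR n E t) = F.eval (t : ℂ) / sqrtR n E t :=
      Complex.conj_eq_iff_im.2 (div_sqrtR_im_eq_zero hE (hreal t) ht)
    rw [quotient_eq_mul_sqrtR F (by simp), mul_div_assoc, map_mul, Complex.conj_I, h1]
    ring
  · rw [indicator_of_notMem ht, Complex.conj_eq_iff_im.2 (quotient_im_eq_zero hE (hreal t) ht)]
    ring

lemma integrableOn_bandSet (hE : ∀ l : ℕ, l < 2 * n → E l < E (l + 1)) {F : Polynomial ℂ}
    {m : ℕ} (hF : F.natDegree ≤ m) {κ : ℝ → ℂ}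
    (hκ : IsDecaying n m ((bandSet n E).indicator κ)) :
    IntegrableOn (fun t : ℝ => F.eval (t : ℂ) / sqrtR n E t * κ t) (bandSet n E) := by
  rw [← integrable_indicator_iff measurableSet_bandSet]
  refine ((integrable_quotient_mul hE F hF hκ).const_mul (-Complex.I)).congr
    (Eventually.of_forall fun t => ?_)
  simp only
  by_cases ht : t ∈ bandSet n E
  · rw [indicator_of_mem ht, indicator_of_mem ht, quotient_eq_mul_sqrtR F (by simp)]
    linear_combination (exp := 1) (-(F.eval (t : ℂ) / sqrtR n E t * κ t)) * Complex.I_mul_I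
  · rw [indicator_of_notMem ht, indicator_of_notMem ht]
    ring

/-- An integral representation valid in the upper half-plane extends to `ℂ \ Σ_n`. -/
theorem representation_offBands (hE : ∀ l : ℕ, l < 2 * n → E l < E (l + 1)) {F : Polynomial ℂ}
    {m : ℕ} (hF : F.natDegree ≤ m) (hm : m ≤ n + 1)
    (hM : IsHerglotz fun z => Complex.I * F.eval z / sqrtR n E z) {K : ℂ → ℝ → ℂ} (c : ℝ)
    (hdec : ∀ z ∈ offBands n E, IsDecaying n m ((bandSet n E).indicator (K z)))
    (hsub : ∀ (z w : ℂ) (t : ℝ), K z t - K w t = 1 / ((t : ℂ) - z) - 1 / ((t : ℂ) - w))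
    (hconj : ∀ (z : ℂ) (t : ℝ), K (conj z) t = conj (K z t))
    (hup : ∀ z : ℂ, 0 < z.im → quotient n E F z = c + (1 / (Real.pi : ℂ)) *
      ∫ t in bandSet n E, F.eval (t : ℂ) / sqrtR n E t * K z t) {z : ℂ} (hz : z ∈ offBands n E) :
    IntegrableOn (fun t : ℝ => F.eval (t : ℂ) / sqrtR n E t * K z t) (bandSet n E) ∧
    Complex.I * F.eval z / sqrtR n E z = c + (1 / (Real.pi : ℂ)) *
      ∫ t in bandSet n E, F.eval (t : ℂ) / sqrtR n E t * K z t := by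
  have hreal := eval_ofReal_im_of_isHerglotz hM
  refine ⟨integrableOn_bandSet hE hF (hdec z hz), ?_⟩
  rcases lt_trichotomy 0 z.im with him | him | him
  · rw [← quotient_eq_mul_sqrtR F him.le]
    exact hup z him
  · obtain ⟨x, rfl⟩ : ∃ x : ℝ, (x : ℂ) = z := ⟨z.re, Complex.ext rfl (by simpa using him)⟩
    have hx : x ∉ bandSet n E := fun h => hz ⟨x, h, rfl⟩
    have hne : ∀ l ≤ 2 * n, x ≠ E l := fun l hl h => hx (by
      rw [h]
      exact edge_mem_bandSet hE hl)
    rw [← quotient_eq_mul_sqrtR F (by simp)]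
    obtain ⟨d, hd, hdist⟩ := exists_le_norm_sub_of_mem_offBands hz
    -- At height `h` above the gap point the kernels differ by `i h / ((t - x - i h) (t - x))`,
    -- which is at most `h |t - x|^(-2)` in modulus. This is integrable against `F / R^{1/2}` over
    -- the bands, so the band integrals converge as `h → 0`.
    have hsq := (integrableOn_bandSet hE hF (isDecaying_indicator_inv_sub_mul hm
      measurableSet_bandSet hd hdist hd hdist)).norm
    set I₂ := ∫ t in bandSet n E,
      ‖F.eval (t : ℂ) / sqrtR n E t * (((t : ℂ) - x)⁻¹ * ((t : ℂ) - x)⁻¹)‖ with hI₂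
    have hoff : ∀ k, (x : ℂ) + heightSeq k * Complex.I ∈ offBands n E := fun k =>
      mem_offBands_of_im_ne_zero (by simpa using (heightSeq_pos k).ne')
    have hbound : ∀ k, ‖(∫ t in bandSet n E, F.eval (t : ℂ) / sqrtR n E t *
        K (x + heightSeq k * Complex.I) t) -
        ∫ t in bandSet n E, F.eval (t : ℂ) / sqrtR n E t * K x t‖ ≤ heightSeq k * I₂ := by
      intro k
      rw [← integral_sub (integrableOn_bandSet hE hF (hdec _ (hoff k)))
        (integrableOn_bandSet hE hF (hdec _ hz)), hI₂, ← integral_const_mul]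
      refine norm_integral_le_of_norm_le (hsq.const_mul _) ?_
      filter_upwards [ae_restrict_mem measurableSet_bandSet] with t ht
      have h1 : (t : ℂ) ≠ x := fun h => hx (Complex.ofReal_injective h ▸ ht)
      have h2 : (t : ℂ) ≠ x + heightSeq k * Complex.I :=
        ofReal_ne_of_im_ne_zero (by simpa using (heightSeq_pos k).ne') t
      rw [← mul_sub, hsub, one_div, one_div, inv_sub_inv_eq_mul h2 h1, add_sub_cancel_left,
        norm_mul, norm_mul, norm_mul, norm_mul, norm_mul, Complex.norm_I, mul_one,
        Complex.norm_real, Real.norm_of_nonneg (heightSeq_pos k).le]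
      have h3 : ‖((t : ℂ) - (x + heightSeq k * Complex.I))⁻¹‖ ≤ ‖((t : ℂ) - x)⁻¹‖ := by
        rw [norm_inv, norm_inv]
        refine inv_anti₀ (norm_pos_iff.2 (sub_ne_zero.2 h1)) ?_
        rw [← Complex.ofReal_sub, Complex.norm_real]
        simpa using Complex.abs_re_le_norm ((t : ℂ) - (x + heightSeq k * Complex.I))
      calc ‖F.eval (t : ℂ) / sqrtR n E t‖ *
            (heightSeq k * (‖((t : ℂ) - (x + heightSeq k * Complex.I))⁻¹‖ * ‖((t : ℂ) - x)⁻¹‖))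
          ≤ ‖F.eval (t : ℂ) / sqrtR n E t‖ *
            (heightSeq k * (‖((t : ℂ) - x)⁻¹‖ * ‖((t : ℂ) - x)⁻¹‖)) := by
              gcongr
              exact (heightSeq_pos k).le
        _ = _ := by rw [norm_mul (_⁻¹)]; ring
    have hh0 : Tendsto heightSeq atTop (𝓝 0) := tendsto_heightSeq.mono_right nhdsWithin_le_nhds
    have hlim : Tendsto (fun k => ∫ t in bandSet n E, F.eval (t : ℂ) / sqrtR n E t *
        K (x + heightSeq k * Complex.I) t) atTop
        (𝓝 (∫ t in bandSet n E, F.eval (t : ℂ) / sqrtR n E t * K x t)) := by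
      refine tendsto_iff_norm_sub_tendsto_zero.2
        (squeeze_zero (fun _ => norm_nonneg _) hbound ?_)
      simpa using hh0.mul_const I₂
    refine tendsto_nhds_unique ((tendsto_quotient F hne).comp tendsto_heightSeq)
      (((hlim.const_mul _).const_add _).congr fun k => ?_)
    exact (hup _ (by simpa using heightSeq_pos k)).symm
  · obtain ⟨w, hw, rfl⟩ : ∃ w : ℂ, 0 < w.im ∧ conj w = z :=
      ⟨conj z, by simpa using him, Complex.conj_conj z⟩
    have h1 := hM.symm w hw
    rw [h1, ← quotient_eq_mul_sqrtR F hw.le, hup w hw, map_add, map_mul, Complex.conj_ofReal,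
      map_div₀, map_one, Complex.conj_ofReal, ← integral_conj]
    congr 2
    refine setIntegral_congr_fun measurableSet_bandSet fun t ht => ?_
    rw [map_mul, hconj, Complex.conj_eq_iff_im.2 (div_sqrtR_im_eq_zero hE (hreal t) ht)]

/-- Since `t / (1 + t²)` is the mean of `1 / (t - i)` and `1 / (t + i)`, the regularized kernel is a
mean of two difference kernels, to which the contour integrals apply. -/
lemma one_div_sub_sub_div_eq (z : ℂ) (t : ℝ) : 1 / ((t : ℂ) - z) - (t : ℂ) / (1 + (t : ℂ) ^ 2) =
    1 / 2 * (((t : ℂ) - z)⁻¹ - ((t : ℂ) - Complex.I)⁻¹) +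
      1 / 2 * (((t : ℂ) - z)⁻¹ - ((t : ℂ) - -Complex.I)⁻¹) := by
  have h1 : (t : ℂ) - Complex.I ≠ 0 :=
    sub_ne_zero.2 (ofReal_ne_of_im_ne_zero (by simp) t)
  have h2 : (t : ℂ) - -Complex.I ≠ 0 :=
    sub_ne_zero.2 (ofReal_ne_of_im_ne_zero (by simp) t)
  have h3 : (1 + (t : ℂ) ^ 2) = ((t : ℂ) - Complex.I) * ((t : ℂ) - -Complex.I) := by
    linear_combination (exp := 1) Complex.I_mul_I
  rw [h3]
  field_simp
  ring

theorem representation_of_natDegree_eq (hE : ∀ l : ℕ, l < 2 * n → E l < E (l + 1))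
    {F : Polynomial ℂ} (hF : F.natDegree = n)
    (hM : IsHerglotz fun z => Complex.I * F.eval z / sqrtR n E z) {z : ℂ}
    (hz : z ∈ offBands n E) :
    IntegrableOn (fun x : ℝ => F.eval (x : ℂ) / sqrtR n E (x : ℂ) * (1 / ((x : ℂ) - z)))
      (bandSet n E) volume ∧
    Complex.I * F.eval z / sqrtR n E z = (1 / (Real.pi : ℂ)) *
      ∫ x in bandSet n E, F.eval (x : ℂ) / sqrtR n E (x : ℂ) * (1 / ((x : ℂ) - z)) := by
  have hpi : (Real.pi : ℂ) ≠ 0 := by exact_mod_cast Real.pi_ne_zero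
  have key := representation_offBands hE hF.le (Nat.le_succ n) hM
    (K := fun z t => 1 / ((t : ℂ) - z)) 0 (fun z hz => ?_) (fun z w t => rfl) (fun z t => by simp)
    (fun z hz => ?_) hz
  · simpa only [Complex.ofReal_zero, zero_add] using key
  · obtain ⟨d, hd, hdist⟩ := exists_le_norm_sub_of_mem_offBands hz
    simpa only [one_div] using
      isDecaying_indicator_inv_sub le_rfl measurableSet_bandSet hd hdist
  · have h := setIntegral_bandSet_eq hE hF.le (eval_ofReal_im_of_isHerglotz hM)
      (isDecaying_inv_sub le_rfl hz.ne')
    simp only [map_inv₀, map_sub, Complex.conj_ofReal] at h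
    rw [integral_quotient_mul_inv_sub_upper hE F hF.le hz,
      integral_quotient_mul_inv_sub_lower hE F hF.le (by simpa using hz), map_zero, sub_zero] at h
    simp only [one_div, Complex.ofReal_zero, zero_add]
    have h2 : (2 : ℂ) * Complex.I ≠ 0 := by simp
    rw [← div_eq_inv_mul, eq_div_iff hpi]
    refine mul_left_cancel₀ h2 ?_
    rw [h]
    ring

theorem representation_of_natDegree_eq_succ (hE : ∀ l : ℕ, l < 2 * n → E l < E (l + 1))
    {H : Polynomial ℂ} (hH : H.natDegree = n + 1)
    (hM : IsHerglotz fun z => Complex.I * H.eval z / sqrtR n E z) {z : ℂ}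
    (hz : z ∈ offBands n E) :
    IntegrableOn (fun x : ℝ => H.eval (x : ℂ) / sqrtR n E (x : ℂ)
        * (1 / ((x : ℂ) - z) - (x : ℂ) / (1 + (x : ℂ) ^ 2))) (bandSet n E) volume ∧
    Complex.I * H.eval z / sqrtR n E z =
      (((Complex.I * H.eval Complex.I / sqrtR n E Complex.I).re : ℝ) : ℂ) + (1 / (Real.pi : ℂ)) *
      ∫ x in bandSet n E, H.eval (x : ℂ) / sqrtR n E (x : ℂ)
        * (1 / ((x : ℂ) - z) - (x : ℂ) / (1 + (x : ℂ) ^ 2)) := by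
  have hpi : (Real.pi : ℂ) ≠ 0 := by exact_mod_cast Real.pi_ne_zero
  have hI : (0 : ℝ) < Complex.I.im := by simp
  have hnI : (-Complex.I).im < 0 := by simp
  refine representation_offBands hE hH.le le_rfl hM
    (K := fun z t => 1 / ((t : ℂ) - z) - (t : ℂ) / (1 + (t : ℂ) ^ 2)) _ (fun z hz => ?_)
    (fun z w t => by ring) (fun z t => by simp) (fun z hz => ?_) hz
  · obtain ⟨d, hd, hdist⟩ := exists_le_norm_sub_of_mem_offBands hz
    have hq : ∀ q : ℂ, q.im ≠ 0 → IsDecaying n (n + 1) ((bandSet n E).indicator fun t : ℝ =>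
        1 / 2 * (((t : ℂ) - z)⁻¹ - ((t : ℂ) - q)⁻¹)) := fun q hq => by
      have h := (isDecaying_indicator_inv_sub_mul (le_refl (n + 1)) measurableSet_bandSet hd hdist
        (abs_pos.2 hq) fun t _ => le_norm_ofReal_sub q t).const_mul (1 / 2 * (z - q))
      convert h using 2 with t
      by_cases ht : t ∈ bandSet n E
      · rw [indicator_of_mem ht, indicator_of_mem ht, inv_sub_inv_eq_mul
          (fun h => hz ⟨t, ht, h⟩) (ofReal_ne_of_im_ne_zero hq t)]
        ring
      · rw [indicator_of_notMem ht, indicator_of_notMem ht, mul_zero]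
    have h := (hq Complex.I hI.ne').add (hq (-Complex.I) hnI.ne)
    simp_rw [one_div_sub_sub_div_eq]
    rwa [← indicator_add] at h
  · have hK : ∀ t : ℝ, 1 / ((t : ℂ) - z) - (t : ℂ) / (1 + (t : ℂ) ^ 2) =
        (((t : ℂ) - z)⁻¹ - ((t : ℂ) - -Complex.I)⁻¹) +
          (-1 / 2) * (((t : ℂ) - Complex.I)⁻¹ - ((t : ℂ) - -Complex.I)⁻¹) := fun t => by
      rw [one_div_sub_sub_div_eq]; ring
    have hK' : ∀ t : ℝ, conj (1 / ((t : ℂ) - z) - (t : ℂ) / (1 + (t : ℂ) ^ 2)) =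
        (((t : ℂ) - conj z)⁻¹ - ((t : ℂ) - -Complex.I)⁻¹) +
          (-1 / 2) * (((t : ℂ) - Complex.I)⁻¹ - ((t : ℂ) - -Complex.I)⁻¹) := fun t => by
      rw [show conj (1 / ((t : ℂ) - z) - (t : ℂ) / (1 + (t : ℂ) ^ 2)) =
        1 / ((t : ℂ) - conj z) - (t : ℂ) / (1 + (t : ℂ) ^ 2) by simp, one_div_sub_sub_div_eq]
      ring
    have d1 := isDecaying_inv_sub_sub (n := n) (le_refl (n + 1)) hz.ne' hnI.ne
    have d2 := isDecaying_inv_sub_sub (n := n) (le_refl (n + 1)) hI.ne' hnI.ne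
    have hzc : (conj z).im < 0 := by simpa using hz
    have d3 := isDecaying_inv_sub_sub (n := n) (le_refl (n + 1)) hzc.ne hnI.ne
    have h := setIntegral_bandSet_eq hE hH.le (eval_ofReal_im_of_isHerglotz hM)
      (κ := fun t : ℝ => 1 / ((t : ℂ) - z) - (t : ℂ) / (1 + (t : ℂ) ^ 2))
      (by simp_rw [hK]; exact d1.add (d2.const_mul _))
    have split : ∀ p : ℂ, IsDecaying n (n + 1)
          (fun t : ℝ => ((t : ℂ) - p)⁻¹ - ((t : ℂ) - -Complex.I)⁻¹) →
        ∫ t : ℝ, quotient n E H t * ((((t : ℂ) - p)⁻¹ - ((t : ℂ) - -Complex.I)⁻¹) +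
          (-1 / 2) * (((t : ℂ) - Complex.I)⁻¹ - ((t : ℂ) - -Complex.I)⁻¹)) =
        (∫ t : ℝ, quotient n E H t * (((t : ℂ) - p)⁻¹ - ((t : ℂ) - -Complex.I)⁻¹)) +
          (-1 / 2) * (2 * Real.pi * Complex.I * quotient n E H Complex.I) := fun p hp => by
      rw [← integral_quotient_mul_upper hE H hH.le le_rfl hI hnI, ← integral_const_mul,
        ← integral_add (integrable_quotient_mul hE H hH.le hp)
          ((integrable_quotient_mul hE H hH.le d2).const_mul _)]
      congr 1 with t
      ring
    simp_rw [hK'] at h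
    simp_rw [hK] at h ⊢
    rw [split z d1, split (conj z) d3, integral_quotient_mul_upper hE H hH.le le_rfl hz hnI,
      integral_quotient_mul_lower hE H hH.le le_rfl hzc hnI] at h
    -- The two line integrals are `2 π i q(z) - π i q(i)` and `-π i q(i)`. The first minus the
    -- conjugate of the second is `2 π i (q(z) - Re q(i))`, which produces the additive constant.
    rw [← quotient_eq_mul_sqrtR H hI.le, Complex.re_eq_add_conj]
    have h2 : (2 : ℂ) * Complex.I ≠ 0 := by simp
    have h4 : ∀ A B : ℂ, 2 * Complex.I * B = A → B = A / (2 * Complex.I) := fun A B hAB => by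
      rw [eq_div_iff h2, ← hAB, mul_comm]
    rw [h4 _ _ h]
    simp only [map_mul, map_add, map_zero, map_div₀, map_neg, map_one, map_ofNat, Complex.conj_I,
      Complex.conj_ofReal]
    field_simp
    ring

end FiniteBand

end

theorem theorem3 (n : ℕ) (hn : 1 ≤ n) (E : ℕ → ℝ) (hE : ∀ l : ℕ, l < 2 * n → E l < E (l + 1)) :
    -- the form of a Herglotz function with the prescribed boundary behaviour
    (∀ M : ℂ → ℂ, FiniteBand.IsHerglotz M →
      -- `M` is not identically zero
      (∃ z : ℂ, 0 < z.im ∧ M z ≠ 0) →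
      -- purely imaginary boundary values a.e. on the bands
      (∀ᵐ x : ℝ ∂volume, x ∈ FiniteBand.bandSet n E →
        ∃ y : ℝ, FiniteBand.HasBoundaryValue M x ((y : ℂ) * Complex.I)) →
      -- real-valued on the real axis off the bands, where `M` is given by its boundary values
      (∀ x : ℝ, x ∉ FiniteBand.bandSet n E →
        FiniteBand.HasBoundaryValue M x (M x) ∧ (M x).im = 0) →
      Xor
        (∃ F : Polynomial ℝ, F.natDegree = n ∧
          (∀ x : ℝ, E (2 * n) < x → 0 < F.eval x) ∧
          (∀ j : ℕ, 1 ≤ j → j ≤ n →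
            FiniteBand.OneZeroIn F (Set.Icc (E (2 * j - 1)) (E (2 * j)))) ∧
          ∀ z ∈ FiniteBand.offBands n E,
            M z = Complex.I * Polynomial.aeval z F / FiniteBand.sqrtR n E z)
        (∃ H : Polynomial ℝ, H.natDegree = n + 1 ∧
          (∀ x : ℝ, E (2 * n) < x → 0 < H.eval x) ∧
          FiniteBand.OneZeroIn H (Set.Iic (E 0)) ∧
          (∀ j : ℕ, 1 ≤ j → j ≤ n →
            FiniteBand.OneZeroIn H (Set.Icc (E (2 * j - 1)) (E (2 * j)))) ∧
          ∀ z ∈ FiniteBand.offBands n E,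
            M z = Complex.I * Polynomial.aeval z H / FiniteBand.sqrtR n E z)) ∧
    -- the integral representation in the case of degree `n`
    (∀ F : Polynomial ℂ, F.natDegree = n →
      FiniteBand.IsHerglotz (fun z => Complex.I * F.eval z / FiniteBand.sqrtR n E z) →
      ∀ z ∈ FiniteBand.offBands n E,
        IntegrableOn (fun x : ℝ => F.eval (x : ℂ) / FiniteBand.sqrtR n E (x : ℂ)
            * (1 / ((x : ℂ) - z))) (FiniteBand.bandSet n E) volume ∧
        Complex.I * F.eval z / FiniteBand.sqrtR n E z =
          (1 / (Real.pi : ℂ)) * ∫ x in FiniteBand.bandSet n E,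
            F.eval (x : ℂ) / FiniteBand.sqrtR n E (x : ℂ) * (1 / ((x : ℂ) - z))) ∧
    -- the integral representation in the case of degree `n + 1`
    (∀ H : Polynomial ℂ, H.natDegree = n + 1 →
      FiniteBand.IsHerglotz (fun z => Complex.I * H.eval z / FiniteBand.sqrtR n E z) →
      ∀ z ∈ FiniteBand.offBands n E,
        IntegrableOn (fun x : ℝ => H.eval (x : ℂ) / FiniteBand.sqrtR n E (x : ℂ)
            * (1 / ((x : ℂ) - z) - (x : ℂ) / (1 + (x : ℂ) ^ 2)))
          (FiniteBand.bandSet n E) volume ∧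
        Complex.I * H.eval z / FiniteBand.sqrtR n E z =
          (((Complex.I * H.eval Complex.I / FiniteBand.sqrtR n E Complex.I).re : ℝ) : ℂ) +
          (1 / (Real.pi : ℂ)) * ∫ x in FiniteBand.bandSet n E,
            H.eval (x : ℂ) / FiniteBand.sqrtR n E (x : ℂ)
              * (1 / ((x : ℂ) - z) - (x : ℂ) / (1 + (x : ℂ) ^ 2))) := by
  refine ⟨fun M hM hnz hband hgap => FiniteBand.herglotz_form hE hM hnz hband hgap,
    fun F hF hM z hz => FiniteBand.representation_of_natDegree_eq hE hF hM hz,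
    fun H hH hM z hz => FiniteBand.representation_of_natDegree_eq_succ hE hH hM hz⟩
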